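/- **Points.** Fix a set $A$ of atoms. An indexed atom is a pair $(\gamma,s)$ with $\gamma\in A$ and $s$ a finite sequence of integers; $\gamma$ is identified with $(\gamma,())$, and $A'$ is the set of indexed atoms. $D'$ is the least set containing $A'$ and the elements $(\iota,*)$, and closed under $(\iota,\alpha,\beta)$ and under $(\iota,a)$ with $a$ a finite multiset of elements of $D'$, where $\iota\in\{+,-\}$; $D\subseteq D'$ is the part using only atoms from $A$. The dual $\alpha^\perp$ is obtained by exchanging $+$ and $-$ everywhere. For a partial injection $\rho$ of $A'$ whose domain contains all atoms of $\alpha$, $\rho\cdot\alpha$ is obtained by applying $\rho$ to the atoms (similarly for finite sequences of points and for functions with values in $D'$; writing $\rho\cdot x$ includes the claim that it is defined). For $k,d\in\mathbb N$ and $\alpha\in D'$, $\mathrm{dig}^k_d([\alpha])$ is the multiset of the $k^d$ points obtained from $\alpha$ by appending one and the same $s\in\{1,\dots,k\}^d$ to the sequences of all its atoms. **Structures.** A pre-pre-linear proof-structure $\Phi$ consists of finitely many cells, each with a type in $\{\otimes,\parr,1,\bot,!,?\}$ and an arity ($2$ for $\otimes,\parr$; $0$ for $1,\bot$; $1$ for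 $!$; arbitrary for $?$); a finite set of ports; for each cell $l$ a set of $\mathrm{arity}(l)+1$ ports, disjoint for distinct cells, one of them being the principal port of $l$ and the others its auxiliary ports; for each $\otimes$- or $\parr$-cell a chosen left auxiliary port; a number $\#(p)\in\mathbb N$ for each auxiliary port $p$ of a $?$-cell; and a set of wires, i.e. of unordered pairs of distinct ports, such that distinct wires are disjoint, every port that is not principal is on a wire, every port belonging to no cell is wired to a non-principal port, and no wire joins two principal ports. An axiom is a wire between two non-principal ports. A conclusion is a port that does not both belong to a cell and lie on a wire. Let $\le$ be the reflexive transitive closure of the relation relating the principal port of a cell to each of its auxiliary ports, and an auxiliary port to the principal port it is wired to. The depth of a port $p$ is the number of $!$-cells whose principal port is $<p$ plus $\sum\#(q)$ over the auxiliary ports $q\le p$ of $?$-cells. $\Phi$ is a linear proof-structure (LPS) if $\le$ is antisymmetric and the two ports of every axiom have equal depth. An indexed LPS $(\Phi,\mathrm{ind})$ is an LPS with a bijection $\mathrm{ind}$ from its conclusions to $\{1,\dots,n\}$, $n$ being their number. An isomorphism of indexed LPS consists of bijections of the cells and of the ports that preserve types, arities, ports of cells, principal and left ports, $\#$, wires (in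 both directions) and the indexing. **Experiments.** A $k$-experiment of $\Phi$ is a function $e$ from the ports to $D'$ such that the principal port of a cell with (left, right) auxiliary ports labelled $\alpha,\beta$ is labelled $(+,\alpha,\beta)$ for $\otimes$ and $(-,\alpha,\beta)$ for $\parr$; it is labelled $(+,*)$ for $1$, $(-,*)$ for $\bot$, $(+,\mathrm{dig}^k_1([e(p)]))$ for a $!$-cell with auxiliary port $p$, and $(-,\sum_p\mathrm{dig}^k_{\#(p)}([e(p)]))$, with $p$ ranging over the auxiliary ports, for a $?$-cell; the ports $p,q$ of an axiom satisfy $e(p)=e(q)^\perp\in D$; and the two ports of any other wire have equal labels. It is atomic if all ports of axioms have labels in $A$, and injective if labels of ports of distinct axioms have no atom in common. A $k$-experiment of $(\Phi,\mathrm{ind})$ is a pair $(e,r)$ with $e$ a $k$-experiment of $\Phi$ and $r=e\circ\mathrm{ind}^{-1}$, its result. **Proposition.** Let $(\Phi,\mathrm{ind})$ and $(\Phi',\mathrm{ind}')$ be indexed LPS and let $k\in\mathbb N$ be strictly greater than the maximal arity of the $?$-cells of $\Phi$ and than that of $\Phi'$ (the maximum being $0$ if there is no $?$-cell). Let $(e,r)$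 and $(e',r')$ be $k$-experiments of $(\Phi,\mathrm{ind})$ and $(\Phi',\mathrm{ind}')$ such that $e$ and $e'$ are atomic and injective. If there are partial injections $\rho,\rho'$ of $A'$ with $\rho\cdot r=\rho'\cdot r'$, then $(e,r)$ and $(e',r')$ are isomorphic up to renaming of atoms: there are an isomorphism $\varphi:(\Phi,\mathrm{ind})\simeq(\Phi',\mathrm{ind}')$ and partial injections $\tau,\tau'$ of $A'$ such that $(\tau\cdot e)(p)=(\tau'\cdot e')(\varphi(p))$ for every port $p$ of $\Phi$, and $\tau\cdot r=\tau'\cdot r'$. In particular $(\Phi,\mathrm{ind})\simeq(\Phi',\mathrm{ind}')$. -/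

import Mathlib

universe u v w u' v' z

namespace PNet

/-! ### Points: trees over atoms with finite multisets -/

/-- The two polarities `+` and `-`. -/
inductive Polarity : Type
  | pos
  | neg

/-- `+^⊥ = -` and `-^⊥ = +`. -/
def Polarity.flip : Polarity → Polarity
  | .pos => .neg
  | .neg => .pos

/-- Ordered representatives of points: here a finite multiset is listed in some order. -/
inductive PrePoint (X : Type u) : Type u
  | atom (x : X) : PrePoint X
  | star (i : Polarity) : PrePoint X
  | pair (i : Polarity) (a b : PrePoint X) : PrePoint X
  | bag (i : Polarity) (n : ℕ) (f : Fin n → PrePoint X) : PrePoint X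

/-- Two representatives are related when they differ only by the order in which
the finite multisets are listed, at every level. -/
inductive PrePoint.Rel {X : Type u} : PrePoint X → PrePoint X → Prop
  | atom (x : X) : Rel (.atom x) (.atom x)
  | star (i : Polarity) : Rel (.star i) (.star i)
  | pair (i : Polarity) {a a' b b' : PrePoint X} (ha : Rel a a') (hb : Rel b b') :
      Rel (.pair i a b) (.pair i a' b')
  | bag (i : Polarity) {n m : ℕ} {f : Fin n → PrePoint X} {g : Fin m → PrePoint X}
      (s : Fin n ≃ Fin m) (h : ∀ j, Rel (f j) (g (s j))) :
      Rel (.bag i n f) (.bag i m g)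

theorem PrePoint.Rel.refl {X : Type u} (a : PrePoint X) : Rel a a := by
  induction a with
  | atom x => exact .atom x
  | star i => exact .star i
  | pair i a b ha hb => exact .pair i ha hb
  | bag i n f ih => exact .bag i (Equiv.refl _) ih

theorem PrePoint.Rel.symm {X : Type u} {a b : PrePoint X} (h : Rel a b) : Rel b a := by
  induction h with
  | atom x => exact .atom x
  | star i => exact .star i
  | pair i _ _ ha hb => exact .pair i ha hb
  | @bag i n m f g s _ ih =>
    refine .bag i s.symm fun j => ?_
    simpa using ih (s.symm j)

theorem PrePoint.Rel.trans {X : Type u} {a b c : PrePoint X} (h : Rel a b) (h' : Rel b c) :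
    Rel a c := by
  induction h generalizing c with
  | atom x => exact h'
  | star i => exact h'
  | pair i _ _ ha hb =>
    cases h' with
    | pair _ ha' hb' => exact .pair i (ha ha') (hb hb')
  | @bag i n m f g s _ ih =>
    cases h' with
    | bag _ s' h' => exact .bag i (s.trans s') fun j => ih j (h' (s j))

instance PrePoint.setoid (X : Type u) : Setoid (PrePoint X) where
  r := PrePoint.Rel
  iseqv := ⟨PrePoint.Rel.refl, PrePoint.Rel.symm, PrePoint.Rel.trans⟩

/-- The points over a set `X` of atoms: the least set containing `X` and the `(ι, *)`, and
closed under `(ι, α, β)` and under `(ι, [α₁, …, αₘ])` for finite multisets `[α₁, …, αₘ]`. -/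
def Point (X : Type u) : Type u := Quotient (PrePoint.setoid X)

namespace Point

variable {X : Type u} {Y : Type v}

/-- The point given by an atom. -/
def atom (x : X) : Point X := Quotient.mk _ (.atom x)

/-- The point `(ι, *)`. -/
def star (i : Polarity) : Point X := Quotient.mk _ (.star i)

/-- The point `(ι, α, β)`. -/
def pair (i : Polarity) (a b : Point X) : Point X :=
  Quotient.map₂ (PrePoint.pair i) (fun _ _ ha _ _ hb => PrePoint.Rel.pair i ha hb) a b

/-- The point `(ι, [f 0, …, f (n - 1)])`. -/
noncomputable def bagFn (i : Polarity) (n : ℕ) (f : Fin n → Point X) : Point X :=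
  Quotient.mk _ (.bag i n fun j => (f j).out)

/-- The point `(ι, a)` for a finite multiset `a` of points. -/
noncomputable def bag (i : Polarity) (a : Multiset (Point X)) : Point X :=
  bagFn i a.toList.length a.toList.get

end Point

/-- Renaming of the atoms along a function. -/
def PrePoint.map {X : Type u} {Y : Type v} (f : X → Y) : PrePoint X → PrePoint Y
  | .atom x => .atom (f x)
  | .star i => .star i
  | .pair i a b => .pair i (a.map f) (b.map f)
  | .bag i n g => .bag i n fun j => (g j).map f

/-- Linear negation: all polarities are flipped. -/
def PrePoint.perp {X : Type u} : PrePoint X → PrePoint X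
  | .atom x => .atom x
  | .star i => .star i.flip
  | .pair i a b => .pair i.flip a.perp b.perp
  | .bag i n g => .bag i.flip n fun j => (g j).perp

/-- The set of atoms occurring in a representative. -/
def PrePoint.atoms {X : Type u} : PrePoint X → Set X
  | .atom x => {x}
  | .star _ => ∅
  | .pair _ a b => a.atoms ∪ b.atoms
  | .bag _ _ g => ⋃ j, (g j).atoms

theorem PrePoint.Rel.map {X : Type u} {Y : Type v} (f : X → Y) {a b : PrePoint X}
    (h : Rel a b) : Rel (a.map f) (b.map f) := by
  induction h with
  | atom x => exact .atom _
  | star i => exact .star i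
  | pair i _ _ ha hb => exact .pair i ha hb
  | bag i s _ ih => exact .bag i s ih

theorem PrePoint.Rel.perp {X : Type u} {a b : PrePoint X}
    (h : Rel a b) : Rel a.perp b.perp := by
  induction h with
  | atom x => exact .atom _
  | star i => exact .star _
  | pair i _ _ ha hb => exact .pair _ ha hb
  | bag i s _ ih => exact .bag _ s ih

theorem PrePoint.Rel.atoms_eq {X : Type u} {a b : PrePoint X}
    (h : Rel a b) : a.atoms = b.atoms := by
  induction h with
  | atom x => rfl
  | star i => rfl
  | pair i _ _ ha hb => simp only [PrePoint.atoms, ha, hb]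
  | @bag i n m f g s _ ih =>
    simp only [PrePoint.atoms, ih]
    exact s.surjective.iUnion_comp fun j => (g j).atoms

namespace Point

variable {X : Type u} {Y : Type v}

/-- Renaming of the atoms of a point along a function. -/
def map (f : X → Y) : Point X → Point Y :=
  Quotient.map (PrePoint.map f) fun _ _ h => PrePoint.Rel.map f h

/-- Linear negation `α^⊥`: all polarities are flipped, the atoms stay. -/
def perp : Point X → Point X :=
  Quotient.map PrePoint.perp fun _ _ h => PrePoint.Rel.perp h

/-- The set of atoms occurring in a point. -/
def atoms : Point X → Set X :=
  Quotient.lift PrePoint.atoms fun _ _ h => PrePoint.Rel.atoms_eq h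

/-! The operations satisfy the expected recursive equations. -/

theorem map_atom (f : X → Y) (x : X) : map f (atom x) = atom (f x) := rfl

theorem map_star (f : X → Y) (i : Polarity) : map f (star i) = star i := rfl

theorem map_pair (f : X → Y) (i : Polarity) (a b : Point X) :
    map f (pair i a b) = pair i (map f a) (map f b) :=
  Quotient.inductionOn₂ a b fun _ _ => rfl

theorem bagFn_equiv (i : Polarity) {n m : ℕ} (f : Fin n → Point X) (g : Fin m → Point X)
    (s : Fin n ≃ Fin m) (h : ∀ j, f j = g (s j)) : bagFn i n f = bagFn i m g :=
  Quotient.sound (.bag i s fun j => by rw [h j]; exact PrePoint.Rel.refl _)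

theorem exists_equiv_of_ofFn_perm {T : Type w} {n m : ℕ} (f : Fin n → T) (g : Fin m → T)
    (h : (Finset.univ.val.map f : Multiset T) = Finset.univ.val.map g) :
    ∃ s : Fin n ≃ Fin m, ∀ j, f j = g (s j) := by
  classical
  have hl : ∀ {d : ℕ} (q : Fin d → T) (t : T),
      Fintype.card {j // q j = t} = Multiset.count t (Finset.univ.val.map q) := by
    intro d q t
    rw [Fintype.card_subtype, Multiset.count_map, Finset.card_def, Finset.filter_val]
    congr 2
    funext j
    exact propext eq_comm
  have hc : ∀ t, Fintype.card {j // f j = t} = Fintype.card {j // g j = t} := by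
    intro t
    rw [hl, hl, h]
  exact ⟨Equiv.ofFiberEquiv fun t => Fintype.equivOfCardEq (hc t),
    fun j => (Equiv.ofFiberEquiv_map _ j).symm⟩

theorem map_get_toList {T : Type w} (a : Multiset T) :
    (Finset.univ.val.map a.toList.get : Multiset T) = a := by
  rw [Fin.univ_val_map, List.ofFn_get, Multiset.coe_toList]

theorem bag_univ (i : Polarity) {n : ℕ} (f : Fin n → Point X) :
    bag i (Finset.univ.val.map f) = bagFn i n f := by
  obtain ⟨s, hs⟩ := exists_equiv_of_ofFn_perm _ f (map_get_toList (Finset.univ.val.map f))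
  exact bagFn_equiv i _ f s hs

theorem map_bagFn (f : X → Y) (i : Polarity) {n : ℕ} (g : Fin n → Point X) :
    map f (bagFn i n g) = bagFn i n fun j => map f (g j) :=
  Quotient.sound (.bag i (Equiv.refl _) fun j => Quotient.exact
    ((congrArg (map f) (Quotient.out_eq (g j))).trans (Quotient.out_eq _).symm))

theorem map_bag (f : X → Y) (i : Polarity) (a : Multiset (Point X)) :
    map f (bag i a) = bag i (a.map (map f)) := by
  conv_rhs => rw [← map_get_toList a, Multiset.map_map, bag_univ]
  exact map_bagFn f i _

theorem perp_atom (x : X) : perp (atom x) = atom x := rfl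

theorem perp_star (i : Polarity) : perp (star i : Point X) = star i.flip := rfl

theorem perp_pair (i : Polarity) (a b : Point X) :
    perp (pair i a b) = pair i.flip (perp a) (perp b) :=
  Quotient.inductionOn₂ a b fun _ _ => rfl

theorem perp_bag (i : Polarity) (a : Multiset (Point X)) :
    perp (bag i a) = bag i.flip (a.map perp) := by
  conv_rhs => rw [← map_get_toList a, Multiset.map_map, bag_univ]
  exact Quotient.sound (.bag _ (Equiv.refl _) fun j => Quotient.exact
    ((congrArg perp (Quotient.out_eq (a.toList.get j))).trans (Quotient.out_eq _).symm))

theorem atoms_atom (x : X) : atoms (atom x) = {x} := rfl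

theorem atoms_star (i : Polarity) : atoms (star i : Point X) = ∅ := rfl

theorem atoms_pair (i : Polarity) (a b : Point X) :
    atoms (pair i a b) = atoms a ∪ atoms b :=
  Quotient.inductionOn₂ a b fun _ _ => rfl

theorem atoms_bag (i : Polarity) (a : Multiset (Point X)) :
    atoms (bag i a) = ⋃ x ∈ a, atoms x := by
  have h : atoms (bag i a) = ⋃ j, atoms (a.toList.get j) :=
    Set.iUnion_congr fun j => congrArg atoms (Quotient.out_eq (a.toList.get j))
  rw [h]
  ext y
  simp only [Set.mem_iUnion, ← Multiset.mem_toList, List.mem_iff_get]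
  constructor
  · rintro ⟨j, hj⟩
    exact ⟨_, ⟨j, rfl⟩, hj⟩
  · rintro ⟨_, ⟨j, rfl⟩, hj⟩
    exact ⟨j, hj⟩

end Point

/-! ### Indexed atoms, renamings, duplication -/

/-- Atoms followed by a finite sequence of integers; the pairs `(γ, [])` are the atoms
themselves. -/
abbrev IAtom (A : Type z) : Type z := A × List ℕ

/-- Points over indexed atoms. -/
abbrev IPoint (A : Type z) : Type z := Point (IAtom A)

variable {A : Type z}

/-- The point lies in the part of `IPoint A` built from the atoms with empty sequence. -/
def IPoint.IsPlain (a : IPoint A) : Prop := ∀ d ∈ a.atoms, d.2 = []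

/-- The point is a single atom with empty sequence. -/
def IPoint.IsPlainAtom (a : IPoint A) : Prop := ∃ g : A, a = Point.atom (g, [])

/-- A partial injection of the indexed atoms is a `PEquiv`. `RenDom t a` says that all atoms
of `a` belong to the domain of `t`. -/
def RenDom (t : IAtom A ≃. IAtom A) (a : IPoint A) : Prop :=
  ∀ d ∈ a.atoms, (t d).isSome

/-- The point `t · a`; only meaningful under `RenDom t a`. -/
def ren (t : IAtom A ≃. IAtom A) (a : IPoint A) : IPoint A :=
  a.map fun d => (t d).getD d

/-- Appending the sequence `s` to the sequence of an indexed atom. -/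
def dig (s : List ℕ) (d : IAtom A) : IAtom A := (d.1, d.2 ++ s)

/-- `digBag k d a` consists of the `k ^ d` copies of `a` obtained by appending to all atoms
the sequences of length `d` with entries in `{1, …, k}`. -/
def digBag (k d : ℕ) (a : Multiset (IPoint A)) : Multiset (IPoint A) :=
  ∑ s : Fin d → Fin k, a.map (Point.map (dig (List.ofFn fun i => (s i : ℕ) + 1)))

/-! ### Cells and ports -/

/-- The types of cells: tensor, par, one, bottom, `!` and `?`. -/
inductive CellType : Type
  | tens
  | parr
  | one
  | bot
  | bang
  | quest

/-- Cells with types and arities. -/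
structure Cells (C : Type u) where
  /-- the type of a cell -/
  type : C → CellType
  /-- the arity of a cell -/
  arity : C → ℕ
  arity_tens : ∀ l, type l = .tens → arity l = 2
  arity_parr : ∀ l, type l = .parr → arity l = 2
  arity_one : ∀ l, type l = .one → arity l = 0
  arity_bot : ∀ l, type l = .bot → arity l = 0
  arity_bang : ∀ l, type l = .bang → arity l = 1

/-- The multiplicative cells. -/
def Cells.IsMult {C : Type u} (S : Cells C) (l : C) : Prop := S.type l = .tens ∨ S.type l = .parr

/-- Cells with their ports. The function `left` is only meaningful on multiplicative cells and
the function `num` only on auxiliary ports of `?`-cells. -/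
structure Ports (C : Type u) (P : Type v) extends Cells C where
  /-- the ports of a cell -/
  ports : C → Finset P
  ports_inj : ∀ l₁ l₂ p, p ∈ ports l₁ → p ∈ ports l₂ → l₁ = l₂
  ports_card : ∀ l, (ports l).card = arity l + 1
  /-- the principal port of a cell -/
  pri : C → P
  pri_mem : ∀ l, pri l ∈ ports l
  /-- the left auxiliary port of a multiplicative cell -/
  left : C → P
  left_mem : ∀ l, toCells.IsMult l → left l ∈ ports l
  left_ne : ∀ l, toCells.IsMult l → left l ≠ pri l
  /-- the number of auxiliary doors of boxes represented by an auxiliary port of a `?`-cell -/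
  num : P → ℕ

namespace Ports

variable {C : Type u} {P : Type v} (S : Ports C P)

open scoped Classical in
/-- The auxiliary ports of a cell. -/
noncomputable def aux (l : C) : Finset P := (S.ports l).erase (S.pri l)

/-- `q` is the right auxiliary port of the multiplicative cell `l`. -/
def IsRight (l : C) (q : P) : Prop := q ∈ S.aux l ∧ q ≠ S.left l

/-- `p` is the principal port of some cell. -/
def IsPri (p : P) : Prop := ∃ l, p = S.pri l

/-- `p` is an auxiliary port of some cell. -/
def IsAux (p : P) : Prop := ∃ l, p ∈ S.aux l

/-- `p` is a port of some cell. -/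
def IsCellPort (p : P) : Prop := ∃ l, p ∈ S.ports l

/-- `p` is an auxiliary port of some `?`-cell. -/
def IsQuestAux (p : P) : Prop := ∃ l, S.type l = .quest ∧ p ∈ S.aux l

open scoped Classical in
/-- The maximal arity of the `?`-cells (`0` if there is no `?`-cell). -/
noncomputable def cosize [Fintype C] : ℕ :=
  (Finset.univ.filter fun l => S.type l = .quest).sup S.arity

end Ports

/-! ### Pre-pre-linear, pre-linear and linear proof-structures -/

/-- Pre-pre-linear proof-structures. The wires, which are unordered pairs of distinct ports, are
given as the edges of a simple graph on the ports. -/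
structure PPLPS (C : Type u) (P : Type v) extends Ports C P where
  /-- the wires -/
  wires : SimpleGraph P
  wires_unique : ∀ p q q', wires.Adj p q → wires.Adj p q' → q = q'
  wires_of_not_pri : ∀ p, ¬ toPorts.IsPri p → ∃ q, wires.Adj p q
  wires_of_not_cellPort : ∀ p, ¬ toPorts.IsCellPort p → ∃ q, ¬ toPorts.IsPri q ∧ wires.Adj p q
  wires_not_cut : ∀ p q, wires.Adj p q → ¬ toPorts.IsPri p ∨ ¬ toPorts.IsPri q

namespace PPLPS

variable {C : Type u} {P : Type v} (F : PPLPS C P)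

/-- The conclusions (free ports). -/
def conclusions : Set P := {p | ¬ (F.IsCellPort p ∧ ∃ q, F.wires.Adj p q)}

/-- The unordered pair of `p` and `q` is an axiom wire. -/
def AxWire (p q : P) : Prop := F.wires.Adj p q ∧ ¬ F.IsPri p ∧ ¬ F.IsPri q

/-- `p` is immediately below `q`. -/
def Below (p q : P) : Prop :=
  (∃ l, p = F.pri l ∧ q ∈ F.aux l) ∨ (F.IsPri q ∧ F.IsAux p ∧ F.wires.Adj p q)

/-- The reflexive transitive closure of `Below`. -/
def Le (p q : P) : Prop := Relation.ReflTransGen F.Below p q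

/-- Pre-linear proof-structures: there are no vicious cycles. -/
def IsPLPS : Prop := ∀ p q, F.Le p q → F.Le q p → p = q

open scoped Classical in
/-- The depth of a port `p`: the number of `!`-cells whose principal port is strictly below `p`,
plus the sum of `num q` over the auxiliary ports `q` of `?`-cells with `q ≤ p`
(those with `num q = 0` contribute nothing). -/
noncomputable def depth [Fintype C] [Fintype P] (p : P) : ℕ :=
  (Finset.univ.filter fun l => F.type l = .bang ∧ F.Le (F.pri l) p ∧ F.pri l ≠ p).card +
    ∑ q ∈ Finset.univ.filter (fun q => F.IsQuestAux q ∧ F.Le q p), F.num q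

/-- Linear proof-structures: the two ports of an axiom wire have the same depth. -/
structure IsLPS [Fintype C] [Fintype P] : Prop where
  isPLPS : F.IsPLPS
  depth_eq : ∀ p q, F.AxWire p q → F.depth p = F.depth q

/-- The indexings: numberings of the conclusions. -/
abbrev Indexing : Type v := F.conclusions ≃ Fin (Nat.card F.conclusions)

/-! ### Experiments -/

/-- `k`-experiments. -/
structure IsExperiment (k : ℕ) (e : P → IPoint A) : Prop where
  tens : ∀ l, F.type l = .tens → ∀ q, F.IsRight l q →
    e (F.pri l) = .pair .pos (e (F.left l)) (e q)
  parr : ∀ l, F.type l = .parr → ∀ q, F.IsRight l q →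
    e (F.pri l) = .pair .neg (e (F.left l)) (e q)
  one : ∀ l, F.type l = .one → e (F.pri l) = .star .pos
  bot : ∀ l, F.type l = .bot → e (F.pri l) = .star .neg
  bang : ∀ l, F.type l = .bang →
    e (F.pri l) = .bag .pos (∑ p ∈ F.aux l, digBag k 1 {e p})
  quest : ∀ l, F.type l = .quest →
    e (F.pri l) = .bag .neg (∑ p ∈ F.aux l, digBag k (F.num p) {e p})
  axWire : ∀ p q, F.AxWire p q → e p = (e q).perp ∧ (e p).IsPlain
  wire : ∀ p q, F.wires.Adj p q → ¬ F.AxWire p q → e p = e q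

/-- Axiom ports are labelled by atoms. -/
def IsAtomic (e : P → IPoint A) : Prop := ∀ p q, F.AxWire p q → (e p).IsPlainAtom

/-- Labels of ports of different axiom wires have no atom in common. -/
def IsInjective (e : P → IPoint A) : Prop :=
  ∀ p q p' q', F.AxWire p q → F.AxWire p' q' →
    ((e p).atoms ∩ (e p').atoms).Nonempty → s(p, q) = s(p', q')

variable {F}

/-- The result of an experiment: the labels of the conclusions, in the order of the indexing. -/
noncomputable def Indexing.result (ind : F.Indexing) (e : P → IPoint A) : List (IPoint A) :=
  List.ofFn fun i => e (ind.symm i)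

end PPLPS

/-! ### Isomorphisms -/

variable {C : Type u} {P : Type v} {C' : Type u'} {P' : Type v'}

/-- Isomorphisms of cells and ports. -/
structure Ports.Iso (S : Ports C P) (S' : Ports C' P') where
  /-- the bijection on cells -/
  cell : C ≃ C'
  /-- the bijection on ports -/
  port : P ≃ P'
  type_eq : ∀ l, S'.type (cell l) = S.type l
  arity_eq : ∀ l, S'.arity (cell l) = S.arity l
  ports_iff : ∀ l p, port p ∈ S'.ports (cell l) ↔ p ∈ S.ports l
  pri_eq : ∀ l, S'.pri (cell l) = port (S.pri l)
  left_eq : ∀ l, S.IsMult l → S'.left (cell l) = port (S.left l)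
  num_eq : ∀ p, S.IsQuestAux p → S'.num (port p) = S.num p

/-- Isomorphisms of pre-pre-linear proof-structures. -/
structure PPLPS.Iso (F : PPLPS C P) (F' : PPLPS C' P') extends
    toPortsIso : Ports.Iso F.toPorts F'.toPorts where
  wires_iff : ∀ p q, F'.wires.Adj (port p) (port q) ↔ F.wires.Adj p q

/-- Isomorphisms of indexed pre-pre-linear proof-structures. -/
structure PPLPS.IndIso {F : PPLPS C P} {F' : PPLPS C' P'} (ind : F.Indexing)
    (ind' : F'.Indexing) extends toPPLPSIso : PPLPS.Iso F F' where
  ind_eq : ∀ c : F.conclusions, ∃ h : port c ∈ F'.conclusions,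
    (ind' ⟨port c, h⟩ : ℕ) = ind c

/-- Two sequences of points are defined and equal after renaming their atoms by `t` and `t'`. -/
def EqUnderRen (t t' : IAtom A ≃. IAtom A) (r r' : List (IPoint A)) : Prop :=
  (∀ a ∈ r, RenDom t a) ∧ (∀ a ∈ r', RenDom t' a) ∧ r.map (ren t) = r'.map (ren t')

/-- Isomorphism of the indexed experiments `(e, r)` and `(e', r')` up to renaming of atoms: there
are partial injections `t`, `t'` such that `t · e` and `t' · e'` are defined and correspond to
each other along an isomorphism of the indexed structures, and `t · r = t' · r'`. -/
def PPLPS.ExpIsoAt {F : PPLPS C P} {F' : PPLPS C' P'} (ind : F.Indexing)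
    (ind' : F'.Indexing) (e : P → IPoint A) (r : List (IPoint A))
    (e' : P' → IPoint A) (r' : List (IPoint A)) : Prop :=
  ∃ (f : PPLPS.IndIso ind ind') (t t' : IAtom A ≃. IAtom A),
    (∀ p, RenDom t (e p)) ∧ (∀ p', RenDom t' (e' p')) ∧
    (∀ p, ren t (e p) = ren t' (e' (f.port p))) ∧
    EqUnderRen t t' r r'

end PNet

/-! The ports of an LPS form a forest growing from the conclusions: an auxiliary port sits above the
principal port of its cell, a principal port above the auxiliary port it is wired to, and axioms
pair ports of equal depth. Taking one copy of each port of depth `n` for every sequence of `n`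
indices in `Fin k` gives the expansion of the forest. The result of an atomic `k`-experiment
displays exactly this expansion: a label is built from the labels of the children, and the two ends
of a copy of an axiom carry the same indexed atom. Injectivity says that no other axiom copy carries
this atom, so results that agree up to renaming give an isomorphism of expansions
(`exists_nodeIso`). This isomorphism respects cell types, left ports and the numbering of the
conclusions, but a priori neither the depths nor the grouping of the copies by ports.

The expansion is then folded back one level at a time. `Node k D` forgets the `D` outermost indices:
`D = 0` is the full expansion, large `D` the forest itself. The passage from `D` to `D + 1` has two
halves. (1) The isomorphism is corrected so that nodes without remaining indices correspond to each
other (`exists_flat_iff`). The label of a port gives its depth relative to its parent, except at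
auxiliary ports of `?`-cells. There a count decides: permuting the outermost index is an
automorphism, so an invariant set contains a multiple of `k` nodes that carry indices, whereas fewer
than `k` ports share a `?`-cell. (2) The nodes of depth greater than `D` now form `k` copies of the
same nodes at level `D + 1`, and the factor `Fin k` is cancelled by Hall's theorem
(`exists_equiv_of_prod_equiv`, `exists_succ`).

In the end there is a bijection of ports preserving parents, axioms, labels and depths. Differences
of depth return the numbers `num`, so it is an isomorphism of structures (`indIso`). Matching the
atoms of corresponding axioms defines a renaming, which propagates from the axioms to all labels
(`exists_ren`). -/

namespace PNet

/-! ### Cancellation of a finite factor -/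

/-- A finite algebra of unary operations can be cancelled from a product with a finite set. -/
theorem exists_equiv_of_prod_equiv {X Y κ ι Λ : Type*} [Finite X] [Finite Y] [Finite κ]
    [Nonempty κ] (a : ι → X → X) (b : ι → Y → Y) (la : X → Λ) (lb : Y → Λ)
    (ψ : X × κ ≃ Y × κ)
    (hop : ∀ i x j, ψ (a i x, j) = (b i (ψ (x, j)).1, (ψ (x, j)).2))
    (hlab : ∀ x j, lb (ψ (x, j)).1 = la x) :
    ∃ θ : X ≃ Y, (∀ i x, θ (a i x) = b i (θ x)) ∧ ∀ x, lb (θ x) = la x := by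
  classical
  have := Fintype.ofFinite X
  have := Fintype.ofFinite Y
  have := Fintype.ofFinite κ
  let sX : Setoid X := Relation.EqvGen.setoid fun x y => ∃ i, y = a i x
  let sY : Setoid Y := Relation.EqvGen.setoid fun x y => ∃ i, y = b i x
  have h2 : ∀ {x y}, sX.r x y → ∀ j, (ψ (x, j)).2 = (ψ (y, j)).2 ∧
      sY.r (ψ (x, j)).1 (ψ (y, j)).1 := by
    intro x y h
    induction h with
    | rel x y h =>
      obtain ⟨i, rfl⟩ := h
      intro j
      rw [hop]
      exact ⟨rfl, .rel _ _ ⟨i, rfl⟩⟩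
    | refl x => exact fun j => ⟨rfl, .refl _⟩
    | symm x y _ ih => exact fun j => ⟨(ih j).1.symm, .symm _ _ (ih j).2⟩
    | trans x y z _ _ ih ih' =>
      exact fun j => ⟨(ih j).1.trans (ih' j).1, .trans _ _ _ (ih j).2 (ih' j).2⟩
  have hop' : ∀ i y j, ψ.symm (b i y, j) = (a i (ψ.symm (y, j)).1, (ψ.symm (y, j)).2) := by
    intro i y j
    rw [Equiv.symm_apply_eq, hop]
    simp
  have h3 : ∀ {x y}, sY.r x y → ∀ j, (ψ.symm (x, j)).2 = (ψ.symm (y, j)).2 ∧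
      sX.r (ψ.symm (x, j)).1 (ψ.symm (y, j)).1 := by
    intro x y h
    induction h with
    | rel x y h =>
      obtain ⟨i, rfl⟩ := h
      intro j
      rw [hop']
      exact ⟨rfl, .rel _ _ ⟨i, rfl⟩⟩
    | refl x => exact fun j => ⟨rfl, .refl _⟩
    | symm x y _ ih => exact fun j => ⟨(ih j).1.symm, .symm _ _ (ih j).2⟩
    | trans x y z _ _ ih ih' =>
      exact fun j => ⟨(ih j).1.trans (ih' j).1, .trans _ _ _ (ih j).2 (ih' j).2⟩
  -- Operations do not change the index in `κ`, so `ψ` sends each copy of a connected component into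
  -- a single copy of a single component; `Ψ` records which one.
  let Ψ : Quotient sX × κ → Quotient sY × κ := fun c =>
    (Quotient.mk sY (ψ (c.1.out, c.2)).1, (ψ (c.1.out, c.2)).2)
  have hΨ : Function.Injective Ψ := by
    rintro ⟨c, i⟩ ⟨d, j⟩ h
    obtain ⟨h₁, h₂⟩ := Prod.mk.inj h
    have h₁ : sY.r (ψ (c.out, i)).1 (ψ (d.out, j)).1 := Quotient.exact h₁
    have h₂ : (ψ (c.out, i)).2 = (ψ (d.out, j)).2 := h₂
    obtain ⟨h₃, h₄⟩ := h3 h₁ (ψ (c.out, i)).2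
    rw [Prod.mk.eta, Equiv.symm_apply_apply, h₂, Prod.mk.eta, Equiv.symm_apply_apply] at h₃ h₄
    refine Prod.ext ?_ h₃
    rw [← Quotient.out_eq c, ← Quotient.out_eq d]
    exact Quotient.sound h₄
  -- Hall's condition: `Ψ` embeds `S × κ` into the product of the neighbours of `S` with `κ`, and
  -- `κ` is finite and nonempty.
  obtain ⟨m, hm, hmr⟩ := (Fintype.all_card_le_filter_rel_iff_exists_injective
    (fun (c : Quotient sX) (d : Quotient sY) => ∃ j, (Ψ (c, j)).1 = d)).mp (by
      intro S
      have := Finset.card_le_card_of_injOn (s := S ×ˢ (Finset.univ : Finset κ))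
        (t := (Finset.univ.filter fun d => ∃ c ∈ S, ∃ j, (Ψ (c, j)).1 = d) ×ˢ Finset.univ) Ψ
        (by
          rintro ⟨c, j⟩ h
          simp only [Finset.coe_product, Set.mem_prod, Finset.mem_coe] at h
          simp only [Finset.coe_product, Set.mem_prod, Finset.mem_coe, Finset.mem_filter,
            Finset.mem_univ, true_and, and_true]
          exact ⟨c, h.1, j, rfl⟩) hΨ.injOn
      rw [Finset.card_product, Finset.card_product] at this
      exact Nat.le_of_mul_le_mul_right this (Finset.card_pos.mpr Finset.univ_nonempty))
  choose J hJ using hmr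
  have hcl : ∀ x, Quotient.mk sY (ψ (x, J (Quotient.mk sX x))).1 = m (Quotient.mk sX x) := by
    intro x
    rw [← hJ]
    exact Quotient.sound (h2 (Setoid.symm (Quotient.mk_out x)) _).2
  -- Each component travels through the one copy that Hall's theorem selects. The copy is constant
  -- on components, so `θ` commutes with the operations; distinct components have distinct targets,
  -- so it is injective, and cardinalities make it bijective.
  let θ : X → Y := fun x => (ψ (x, J (Quotient.mk sX x))).1
  have hθ : Function.Injective θ := by
    intro x y h
    have hc : Quotient.mk sX x = Quotient.mk sX y := hm (by rw [← hcl, ← hcl]; exact congrArg _ h)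
    have h' : (ψ (x, J (Quotient.mk sX x))).1 = (ψ (y, J (Quotient.mk sX y))).1 := h
    rw [hc] at h'
    have := ψ.injective (Prod.ext h' (h2 (Quotient.exact hc) _).1)
    exact (Prod.mk.inj this).1
  have hcard : Fintype.card X = Fintype.card Y := by
    have := Fintype.card_congr ψ
    rw [Fintype.card_prod, Fintype.card_prod] at this
    exact Nat.eq_of_mul_eq_mul_right Fintype.card_pos this
  refine ⟨Equiv.ofBijective θ ((Fintype.bijective_iff_injective_and_card θ).mpr ⟨hθ, hcard⟩),
    fun i x => ?_, fun x => hlab _ _⟩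
  have hc : Quotient.mk sX (a i x) = Quotient.mk sX x :=
    Quotient.sound (.symm _ _ (.rel _ _ ⟨i, rfl⟩))
  change (ψ (a i x, J (Quotient.mk sX (a i x)))).1 = b i (ψ (x, J (Quotient.mk sX x))).1
  rw [hc, hop]

/-! ### Forests with depths and their truncated expansions -/

/-- A forest with an operation matching nodes of equal depth; `par` fixes the roots. -/
structure BoxForest (V : Type*) (L : Type*) where
  /-- the parent of a node, a root being its own parent -/
  par : V → V
  /-- the partner of a node -/
  prt : V → V
  /-- the label of a node -/
  lab : V → L
  /-- the depth of a node -/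
  dep : V → ℕ
  dep_par : ∀ v, dep (par v) ≤ dep v
  dep_prt : ∀ v, dep (prt v) = dep v
  dep_root : ∀ v, par v = v → dep v = 0
  exists_height : ∃ h : V → ℕ, ∀ v, par v ≠ v → h (par v) < h v

namespace BoxForest

variable {V V' L : Type*} (S : BoxForest V L) (S' : BoxForest V' L) (k D : ℕ)

/-- The nodes of the `k`-fold expansion above depth `D`; the outermost index comes first. -/
def Node : Type _ := {x : V × List (Fin k) // x.2.length = S.dep x.1 - D}

instance [Finite V] : Finite (S.Node k D) := by
  classical
  have := Fintype.ofFinite V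
  let N := Finset.univ.sup S.dep
  have : Finite {l : List (Fin k) // l.length ≤ N} := List.finite_length_le _ _
  refine Finite.of_injective (β := V × {l : List (Fin k) // l.length ≤ N})
    (fun x => (x.1.1, ⟨x.1.2, ?_⟩)) ?_
  · have := Finset.le_sup (f := S.dep) (Finset.mem_univ x.1.1)
    have := x.2
    omega
  · rintro ⟨⟨v, t⟩, hx⟩ ⟨⟨w, s⟩, hy⟩ h
    obtain ⟨h₁, h₂⟩ := Prod.mk.inj h
    exact Subtype.ext (Prod.ext h₁ (Subtype.ext_iff.mp h₂))

variable {S S' k D}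

namespace Node

theorem ext' {x y : S.Node k D} (h : x.1.1 = y.1.1) (h' : x.1.2 = y.1.2) : x = y :=
  Subtype.ext (Prod.ext h h')

/-- The parent of a node of the expansion. -/
def par (x : S.Node k D) : S.Node k D :=
  ⟨(S.par x.1.1, x.1.2.take (S.dep (S.par x.1.1) - D)), by
    have := x.2
    have := S.dep_par x.1.1
    simp only [List.length_take]
    omega⟩

/-- The partner of a node of the expansion. -/
def prt (x : S.Node k D) : S.Node k D :=
  ⟨(S.prt x.1.1, x.1.2), by rw [S.dep_prt]; exact x.2⟩

/-- The nodes that have a single copy. -/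
def Flat (x : S.Node k D) : Prop := x.1.2 = []

theorem flat_iff {x : S.Node k D} : x.Flat ↔ S.dep x.1.1 ≤ D := by
  have := x.2
  rw [Flat, ← List.length_eq_zero_iff]
  omega

theorem Flat.eq {x y : S.Node k D} (h : x.Flat) (h' : y.Flat) (e : x.1.1 = y.1.1) : x = y :=
  ext' e (h.trans h'.symm)

theorem Flat.par {x : S.Node k D} (h : x.Flat) : x.par.Flat :=
  flat_iff.mpr ((S.dep_par _).trans (flat_iff.mp h))

theorem par_fst_eq {x : S.Node k D} (h : x.par = x) : S.par x.1.1 = x.1.1 :=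
  congrArg (fun y => y.1.1) h

theorem par_eq {x : S.Node k D} (h : S.par x.1.1 = x.1.1) : x.par = x := by
  refine ext' h ?_
  change x.1.2.take (S.dep (S.par x.1.1) - D) = x.1.2
  rw [h, ← x.2, List.take_length]

end Node

variable (S S' k D) in
/-- Isomorphisms of expansions that preserve the depths below `D`. -/
structure NodeIso where
  /-- the bijection on the nodes -/
  equiv : S.Node k D ≃ S'.Node k D
  map_par : ∀ x, equiv x.par = (equiv x).par
  map_prt : ∀ x, equiv x.prt = (equiv x).prt
  map_lab : ∀ x, S'.lab (equiv x).1.1 = S.lab x.1.1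
  map_dep : ∀ x, min (S'.dep (equiv x).1.1) D = min (S.dep x.1.1) D

namespace NodeIso

/-- The inverse isomorphism. -/
def symm (ψ : S.NodeIso S' k D) : S'.NodeIso S k D where
  equiv := ψ.equiv.symm
  map_par x := by rw [Equiv.symm_apply_eq, ψ.map_par, Equiv.apply_symm_apply]
  map_prt x := by rw [Equiv.symm_apply_eq, ψ.map_prt, Equiv.apply_symm_apply]
  map_lab x := by rw [← ψ.map_lab, Equiv.apply_symm_apply]
  map_dep x := by rw [← ψ.map_dep, Equiv.apply_symm_apply]

/-- The composition of isomorphisms. -/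
def trans {V₁ V₂ V₃ : Type*} {S₁ : BoxForest V₁ L} {S₂ : BoxForest V₂ L} {S₃ : BoxForest V₃ L}
    (ψ : S₁.NodeIso S₂ k D) (χ : S₂.NodeIso S₃ k D) : S₁.NodeIso S₃ k D where
  equiv := ψ.equiv.trans χ.equiv
  map_par x := by simp [ψ.map_par, χ.map_par]
  map_prt x := by simp [ψ.map_prt, χ.map_prt]
  map_lab x := by simp [ψ.map_lab, χ.map_lab]
  map_dep x := by simp [ψ.map_dep, χ.map_dep]

end NodeIso

/-! ### Symmetry in the outermost index -/

/-- Permuting the first index of a sequence. -/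
def headMap (σ : Equiv.Perm (Fin k)) : List (Fin k) → List (Fin k)
  | [] => []
  | a :: t => σ a :: t

theorem headMap_length (σ : Equiv.Perm (Fin k)) (t) : (headMap σ t).length = t.length := by
  cases t <;> rfl

theorem headMap_take (σ : Equiv.Perm (Fin k)) (t) (n : ℕ) :
    headMap σ (t.take n) = (headMap σ t).take n := by
  cases t <;> cases n <;> rfl

theorem headMap_headMap (σ τ : Equiv.Perm (Fin k)) (h : ∀ a, σ (τ a) = a) (t) :
    headMap σ (headMap τ t) = t := by
  cases t <;> simp [headMap, h]

variable (S D) in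
/-- The automorphism of the expansion that permutes the outermost index. -/
def headIso (σ : Equiv.Perm (Fin k)) : S.NodeIso S k D where
  equiv :=
    { toFun := fun x => ⟨(x.1.1, headMap σ x.1.2), by simpa [headMap_length] using x.2⟩
      invFun := fun x => ⟨(x.1.1, headMap σ.symm x.1.2), by simpa [headMap_length] using x.2⟩
      left_inv := fun x => Node.ext' rfl (headMap_headMap _ _ (by simp) _)
      right_inv := fun x => Node.ext' rfl (headMap_headMap _ _ (by simp) _) }
  map_par x := Node.ext' rfl (headMap_take _ _ _)
  map_prt x := rfl
  map_lab x := rfl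
  map_dep x := rfl

theorem headIso_flat (σ : Equiv.Perm (Fin k)) {x : S.Node k D} (h : x.Flat) :
    (S.headIso D σ).equiv x = x := by
  refine Node.ext' rfl ?_
  change headMap σ x.1.2 = x.1.2
  rw [h]; rfl

-- Sort the nodes that carry indices by their first index. Transpositions of indices exchange the
-- classes inside the invariant set `O`, so the `k` classes have the same size.
open scoped Classical in
theorem dvd_card_not_flat (O : Finset (S.Node k D))
    (hO : ∀ σ, ∀ x ∈ O, (S.headIso D σ).equiv x ∈ O) :
    k ∣ (O.filter fun x => ¬ x.Flat).card := by
  have key : ∀ a b : Fin k, (O.filter fun x => x.1.2.head? = some a).card ≤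
      (O.filter fun x => x.1.2.head? = some b).card := by
    intro a b
    refine Finset.card_le_card_of_injOn (S.headIso D (Equiv.swap a b)).equiv ?_
      (Equiv.injective _).injOn
    intro x hx
    simp only [Finset.coe_filter, Set.mem_ofPred_eq] at hx ⊢
    refine ⟨hO _ _ hx.1, ?_⟩
    change (headMap (Equiv.swap a b) x.1.2).head? = _
    cases h : x.1.2 with
    | nil => rw [h] at hx; simp at hx
    | cons c t =>
      rw [h] at hx
      simp only [List.head?_cons, Option.some.injEq] at hx
      simp [headMap, hx.2]
  have hsum : (O.filter fun x => ¬ x.Flat).card =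
      ∑ a : Fin k, (O.filter fun x => x.1.2.head? = some a).card := by
    rw [← Finset.card_biUnion]
    · congr 1
      ext x
      simp only [Finset.mem_filter, Finset.mem_biUnion, Finset.mem_univ, true_and]
      simp only [Node.Flat]
      cases h : x.1.2 <;> simp
    · intro a _ b _ hab
      refine Finset.disjoint_left.mpr fun x hx hx' => hab ?_
      simp only [Finset.mem_filter] at hx hx'
      exact Option.some.inj (hx.2.symm.trans hx'.2)
  rw [hsum]
  rcases k with _ | k
  · simp
  · rw [Finset.sum_congr rfl fun a _ => le_antisymm (key a 0) (key 0 a)]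
    simp

/-! ### Matching the nodes that have a single copy -/

/-- The children of a node are less than `k` when they carry a label in `Q`, and their relative
depth is determined by their label otherwise. -/
structure IsBounded (S : BoxForest V L) (k : ℕ) (Q : Set L) (δ : L → ℕ) : Prop where
  card_lt : ∀ v, S.par v ≠ v → S.lab v ∈ Q → {w | S.par w = S.par v ∧ w ≠ S.par v}.ncard < k
  dep_eq : ∀ v, S.par v ≠ v → S.lab v ∉ Q → S.dep v = S.dep (S.par v) + δ (S.lab v)

namespace NodeIso

/-- Both parents have depth at most `D`, so the truncated depths preserved by `ψ` are their true
depths and agree. The label then adds the same relative depth on both sides. -/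
theorem flat_of_par {Q : Set L} {δ : L → ℕ} (hS : S.IsBounded k Q δ) (hS' : S'.IsBounded k Q δ)
    (ψ : S.NodeIso S' k D) {x : S.Node k D} (hx : x.Flat) (hp : (ψ.equiv x.par).Flat)
    (hQ : S.lab x.1.1 ∉ Q) : (ψ.equiv x).Flat := by
  have hd := ψ.map_dep x.par
  rw [Node.flat_iff] at hx hp ⊢
  by_cases hr : S'.par (ψ.equiv x).1.1 = (ψ.equiv x).1.1
  · rw [S'.dep_root _ hr]; exact Nat.zero_le _
  have hr' : S.par x.1.1 ≠ x.1.1 := by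
    intro h
    apply hr
    have := ψ.map_par x
    rw [Node.par_eq h] at this
    exact Node.par_fst_eq this.symm
  have h₁ := hS.dep_eq _ hr' hQ
  have h₂ := hS'.dep_eq _ hr (by rwa [ψ.map_lab])
  rw [ψ.map_lab] at h₂
  rw [ψ.map_par] at hp hd
  have h₃ : S'.dep (S'.par (ψ.equiv x).1.1) ≤ D := hp
  have h₄ := S.dep_par x.1.1
  have h₅ : min (S'.dep (S'.par (ψ.equiv x).1.1)) D = min (S.dep (S.par x.1.1)) D := hd
  omega

/-- The counting argument. If no admissible correction sends `x` to a flat node, all possible images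
of `x` carry indices and their number is a multiple of `k`. Pulled back by `ψ`, they form an
invariant set whose flat part is then also a multiple of `k`; but this part contains `x` and
consists of children of one node, of which there are fewer than `k`. -/
theorem exists_flat_of_par [Finite V] [Finite V'] {Q : Set L} {δ : L → ℕ}
    (hS : S.IsBounded k Q δ)
    (ψ : S.NodeIso S' k D) {x : S.Node k D} (hx : x.Flat) (hp : (ψ.equiv x.par).Flat)
    (hr : x.par ≠ x) (hQ : S.lab x.1.1 ∈ Q) :
    ∃ χ : S.NodeIso S' k D, (∀ y : S.Node k D, y.Flat → (ψ.equiv y).Flat → χ.equiv y = ψ.equiv y) ∧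
      (χ.equiv x).Flat := by
  classical
  have := Fintype.ofFinite V
  have := Fintype.ofFinite (S.Node k D)
  have := Fintype.ofFinite (S'.Node k D)
  by_contra! hno
  -- All images of `x` under isomorphisms that agree with `ψ` wherever a flat node already has a
  -- flat image. Index permutations fix flat nodes, so composing with them on either side stays
  -- within these isomorphisms.
  let O' : Finset (S'.Node k D) := Finset.univ.filter fun y => ∃ χ : S.NodeIso S' k D,
    (∀ y : S.Node k D, y.Flat → (ψ.equiv y).Flat → χ.equiv y = ψ.equiv y) ∧ χ.equiv x = y
  let O : Finset (S.Node k D) := Finset.univ.filter fun z => ψ.equiv z ∈ O'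
  have hcard : O.card = O'.card := Finset.card_bij (fun z _ => ψ.equiv z)
    (fun z hz => (Finset.mem_filter.mp hz).2) (fun _ _ _ _ h => ψ.equiv.injective h)
    fun y hy => ⟨ψ.equiv.symm y, by simpa [O] using hy, by simp⟩
  have hO' : ∀ σ, ∀ y ∈ O', (S'.headIso D σ).equiv y ∈ O' := by
    intro σ y hy
    obtain ⟨χ, hχ, rfl⟩ := (Finset.mem_filter.mp hy).2
    refine Finset.mem_filter.mpr ⟨Finset.mem_univ _, χ.trans (S'.headIso D σ), fun y h h' => ?_, rfl⟩
    change (S'.headIso D σ).equiv (χ.equiv y) = _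
    rw [hχ y h h', headIso_flat _ h']
  have hO : ∀ σ, ∀ z ∈ O, (S.headIso D σ).equiv z ∈ O := by
    intro σ z hz
    obtain ⟨χ, hχ, hz⟩ := (Finset.mem_filter.mp (Finset.mem_filter.mp hz).2).2
    refine Finset.mem_filter.mpr ⟨Finset.mem_univ _, Finset.mem_filter.mpr ⟨Finset.mem_univ _,
      ((χ.trans ψ.symm).trans (S.headIso D σ)).trans ψ, fun y h h' => ?_, ?_⟩⟩
    · change ψ.equiv ((S.headIso D σ).equiv (ψ.equiv.symm (χ.equiv y))) = _
      rw [hχ y h h', Equiv.symm_apply_apply, headIso_flat _ h]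
    · change ψ.equiv ((S.headIso D σ).equiv (ψ.equiv.symm (χ.equiv x))) = _
      rw [hz, Equiv.symm_apply_apply]
  have h1 : k ∣ O.card := by
    rw [hcard]
    convert dvd_card_not_flat O' hO' using 2
    refine (Finset.filter_true_of_mem fun y hy => ?_).symm
    obtain ⟨χ, hχ, rfl⟩ := (Finset.mem_filter.mp hy).2
    exact hno χ hχ
  have h2 : k ∣ (O.filter fun z => z.Flat).card := by
    rw [← Finset.card_filter_add_card_filter_not (s := O) fun z => z.Flat] at h1
    exact (Nat.dvd_add_left (dvd_card_not_flat O hO)).mp h1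
  have h3 : 0 < (O.filter fun z => z.Flat).card :=
    Finset.card_pos.mpr ⟨x, Finset.mem_filter.mpr ⟨Finset.mem_filter.mpr ⟨Finset.mem_univ _,
      Finset.mem_filter.mpr ⟨Finset.mem_univ _, ψ, fun _ _ _ => rfl, rfl⟩⟩, hx⟩⟩
  -- The flat node `x.par` has a flat image, so all competing isomorphisms agree on it, and every
  -- member of `O` has the parent `x.par`.
  have h4 : (O.filter fun z => z.Flat).card < k := by
    refine lt_of_le_of_lt ?_ (hS.card_lt x.1.1 (fun h => hr (Node.par_eq h)) hQ)
    rw [← Set.ncard_coe_finset]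
    refine Set.ncard_le_ncard_of_injOn (fun z => z.1.1) ?_ ?_ (Set.toFinite _)
    · intro z hz
      obtain ⟨hz, hzf⟩ := Finset.mem_filter.mp hz
      obtain ⟨χ, hχ, hz⟩ := (Finset.mem_filter.mp (Finset.mem_filter.mp hz).2).2
      have hpz : z.par = x.par := by
        apply ψ.equiv.injective
        rw [ψ.map_par, ← hz, ← χ.map_par, hχ _ hx.par hp]
      refine ⟨congrArg (fun y => y.1.1) hpz, fun h => ?_⟩
      have hzx : z = x.par := hzf.eq hx.par h
      rw [hzx] at hz
      rw [← hχ _ hx.par hp] at hz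
      exact hr (χ.equiv.injective hz).symm
    · intro z hz z' hz' h
      exact (Finset.mem_filter.mp hz).2.eq (Finset.mem_filter.mp hz').2 h
  exact absurd (Nat.le_of_dvd h3 h2) (by omega)

/-- It suffices to treat a misplaced flat node of least height. It is not a root, since roots go to
roots and these have depth `0`; by minimality its parent is well placed, so the two previous lemmas
apply. -/
theorem exists_improvement [Finite V] [Finite V'] {Q : Set L} {δ : L → ℕ}
    (hS : S.IsBounded k Q δ) (hS' : S'.IsBounded k Q δ) (ψ : S.NodeIso S' k D)
    (h : ∃ x : S.Node k D, x.Flat ∧ ¬ (ψ.equiv x).Flat) :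
    ∃ χ : S.NodeIso S' k D, (∀ y : S.Node k D, y.Flat → (ψ.equiv y).Flat → (χ.equiv y).Flat) ∧
      ∃ x : S.Node k D, x.Flat ∧ ¬ (ψ.equiv x).Flat ∧ (χ.equiv x).Flat := by
  obtain ⟨ht, hht⟩ := S.exists_height
  obtain ⟨x, ⟨hx, hψ⟩, hmin⟩ := WellFounded.has_min
    (InvImage.wf (fun x : S.Node k D => ht x.1.1) Nat.lt_wfRel.wf)
    {x : S.Node k D | x.Flat ∧ ¬ (ψ.equiv x).Flat} h
  have hr : x.par ≠ x := by
    intro hr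
    apply hψ
    rw [Node.flat_iff]
    have := ψ.map_par x
    rw [hr] at this
    rw [S'.dep_root _ (Node.par_fst_eq this.symm)]
    exact Nat.zero_le _
  have hp : (ψ.equiv x.par).Flat := by
    by_contra hc
    exact hmin x.par ⟨hx.par, hc⟩ (hht _ fun h => hr (Node.par_eq h))
  by_cases hQ : S.lab x.1.1 ∈ Q
  · obtain ⟨χ, hχ, hxχ⟩ := ψ.exists_flat_of_par hS hx hp hr hQ
    exact ⟨χ, fun y h h' => by rwa [hχ y h h'], x, hx, hψ, hxχ⟩
  · exact absurd (ψ.flat_of_par hS hS' hx hp hQ) hψ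

/-- An isomorphism with the largest number of flat nodes having flat images cannot be improved, and
neither can its inverse. The first fact gives one implication, the second the other. -/
theorem exists_flat_iff [Finite V] [Finite V'] {Q : Set L} {δ : L → ℕ}
    (hS : S.IsBounded k Q δ) (hS' : S'.IsBounded k Q δ) (ψ : S.NodeIso S' k D) :
    ∃ χ : S.NodeIso S' k D, ∀ x, (χ.equiv x).Flat ↔ x.Flat := by
  classical
  have := Fintype.ofFinite (S.Node k D)
  have := Fintype.ofFinite (S'.Node k D)
  let good (χ : S.NodeIso S' k D) : Finset (S.Node k D) :=
    Finset.univ.filter fun x => x.Flat ∧ (χ.equiv x).Flat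
  obtain ⟨χ, hχ⟩ : ∃ χ : S.NodeIso S' k D, ∀ χ' : S.NodeIso S' k D,
      (good χ').card ≤ (good χ).card := by
    have hfin : (Set.range fun χ : S.NodeIso S' k D => (good χ).card).Finite :=
      (Set.finite_Iic (Fintype.card (S.Node k D))).subset (by
        rintro _ ⟨χ, rfl⟩; exact Finset.card_le_univ _)
    obtain ⟨_, ⟨χ, rfl⟩, h⟩ := hfin.exists_maximal ⟨_, ψ, rfl⟩
    refine ⟨χ, fun χ' => ?_⟩
    rcases le_total (good χ').card (good χ).card with h' | h'
    · exact h'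
    · exact h ⟨χ', rfl⟩ h'
  refine ⟨χ, fun x => ⟨fun h => ?_, fun h => ?_⟩⟩
  · by_contra hx
    obtain ⟨χ', h₁, y, hy, hy₁, hy₂⟩ := χ.symm.exists_improvement hS' hS ⟨χ.equiv x, h, by
      change ¬ (χ.equiv.symm (χ.equiv x)).Flat
      rwa [Equiv.symm_apply_apply]⟩
    refine absurd (hχ χ'.symm) (not_le.mpr ?_)
    -- The two sets are compared on the side of `S'`, where the inverse `χ'.symm` of the improved
    -- inverse keeps all well placed images and gains `y`.
    have hlt : (good χ).map χ.equiv.toEmbedding ⊂ (good χ'.symm).map χ'.symm.equiv.toEmbedding := by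
      refine Finset.ssubset_iff_of_subset ?_ |>.mpr ⟨y, ?_, ?_⟩
      · intro z hz
        obtain ⟨w, hw, rfl⟩ := Finset.mem_map.mp hz
        obtain ⟨-, hw₁, hw₂⟩ := Finset.mem_filter.mp hw
        refine Finset.mem_map.mpr ⟨χ'.equiv (χ.equiv w), Finset.mem_filter.mpr
          ⟨Finset.mem_univ _, h₁ _ hw₂ ?_, ?_⟩, χ'.equiv.symm_apply_apply _⟩
        · change (χ.equiv.symm (χ.equiv w)).Flat
          rwa [Equiv.symm_apply_apply]
        · change (χ'.equiv.symm (χ'.equiv (χ.equiv w))).Flat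
          rwa [Equiv.symm_apply_apply]
      · refine Finset.mem_map.mpr ⟨χ'.equiv y, Finset.mem_filter.mpr
          ⟨Finset.mem_univ _, hy₂, ?_⟩, χ'.equiv.symm_apply_apply _⟩
        change (χ'.equiv.symm (χ'.equiv y)).Flat
        rwa [Equiv.symm_apply_apply]
      · intro hz
        obtain ⟨w, hw, rfl⟩ := Finset.mem_map.mp hz
        apply hy₁
        change (χ.equiv.symm (χ.equiv w)).Flat
        rw [Equiv.symm_apply_apply]
        exact (Finset.mem_filter.mp hw).2.1
    simpa only [Finset.card_map] using Finset.card_lt_card hlt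
  · by_contra hx
    obtain ⟨χ', h₁, y, hy, hy₁, hy₂⟩ := χ.exists_improvement hS hS' ⟨x, h, hx⟩
    refine absurd (hχ χ') (not_le.mpr (Finset.card_lt_card ?_))
    refine Finset.ssubset_iff_of_subset ?_ |>.mpr ⟨y, ?_, ?_⟩
    · intro z hz
      obtain ⟨-, hz₁, hz₂⟩ := Finset.mem_filter.mp hz
      exact Finset.mem_filter.mpr ⟨Finset.mem_univ _, hz₁, h₁ z hz₁ hz₂⟩
    · exact Finset.mem_filter.mpr ⟨Finset.mem_univ _, hy, hy₂⟩
    · exact fun hz => hy₁ (Finset.mem_filter.mp hz).2.2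

end NodeIso
end BoxForest
-- Removing the outermost index
namespace BoxForest

variable {V V' L : Type*} {S : BoxForest V L} {S' : BoxForest V' L} {k D : ℕ}

namespace Node

/-- Adding an outermost index to a node, unless it has a single copy at depth `D`. -/
def up (x : S.Node k (D + 1)) (a : Fin k) : S.Node k D :=
  ⟨(x.1.1, if S.dep x.1.1 ≤ D then [] else a :: x.1.2), by
    have := x.2
    split_ifs <;> simp only [List.length_nil, List.length_cons] <;> omega⟩

/-- Removing the outermost index. -/
def down (y : S.Node k D) : S.Node k (D + 1) :=
  ⟨(y.1.1, y.1.2.tail), by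
    have := y.2
    simp only [List.length_tail]
    omega⟩

theorem up_down (y : S.Node k D) (a : Fin k) : y.down.up (y.1.2.head?.getD a) = y := by
  refine ext' rfl ?_
  change (if S.dep y.1.1 ≤ D then [] else y.1.2.head?.getD a :: y.1.2.tail) = y.1.2
  have hy := y.2
  split_ifs with h
  · exact (flat_iff.mpr h).symm
  · cases hc : y.1.2 with
    | nil => exact absurd (flat_iff.mp hc) h
    | cons b t => rfl

theorem down_up (x : S.Node k (D + 1)) (a : Fin k) : (x.up a).down = x := by
  refine ext' rfl ?_
  change (if S.dep x.1.1 ≤ D then [] else a :: x.1.2).tail = x.1.2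
  split_ifs with h
  · exact (flat_iff.mpr (h.trans (Nat.le_succ D))).symm
  · rfl

theorem flat_up {x : S.Node k (D + 1)} {a : Fin k} : (x.up a).Flat ↔ S.dep x.1.1 ≤ D :=
  flat_iff

theorem up_prt (x : S.Node k (D + 1)) (a : Fin k) : x.prt.up a = (x.up a).prt := by
  refine ext' rfl ?_
  change (if S.dep (S.prt x.1.1) ≤ D then [] else a :: x.1.2) =
    if S.dep x.1.1 ≤ D then [] else a :: x.1.2
  rw [S.dep_prt]

theorem up_par (x : S.Node k (D + 1)) (a : Fin k) (h : ¬ S.dep (S.par x.1.1) ≤ D) :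
    x.par.up a = (x.up a).par := by
  refine ext' rfl ?_
  change (if S.dep (S.par x.1.1) ≤ D then [] else a :: x.1.2.take (S.dep (S.par x.1.1) - (D + 1))) =
    (if S.dep x.1.1 ≤ D then [] else a :: x.1.2).take (S.dep (S.par x.1.1) - D)
  have := S.dep_par x.1.1
  rw [if_neg h, if_neg (by omega), show S.dep (S.par x.1.1) - D = S.dep (S.par x.1.1) - (D + 1) + 1
    by omega, List.take_succ_cons]

theorem down_par (y : S.Node k D) (h : ¬ S.dep (S.par y.1.1) ≤ D) : y.par.down = y.down.par := by
  refine ext' rfl ?_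
  change (y.1.2.take (S.dep (S.par y.1.1) - D)).tail =
    y.1.2.tail.take (S.dep (S.par y.1.1) - (D + 1))
  rw [show S.dep (S.par y.1.1) - D = S.dep (S.par y.1.1) - (D + 1) + 1 by omega]
  cases y.1.2 <;> simp

theorem head?_par (y : S.Node k D) (h : ¬ S.dep (S.par y.1.1) ≤ D) :
    y.par.1.2.head? = y.1.2.head? := by
  change (y.1.2.take (S.dep (S.par y.1.1) - D)).head? = y.1.2.head?
  rw [show S.dep (S.par y.1.1) - D = S.dep (S.par y.1.1) - (D + 1) + 1 by omega]
  cases y.1.2 <;> rfl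

end Node

namespace NodeIso

/-- The action of an isomorphism with the outermost index separated. -/
def shift (ψ : S.NodeIso S' k D) (p : S.Node k (D + 1) × Fin k) : S'.Node k (D + 1) × Fin k :=
  -- A node of depth at most `D` has no index at level `D`. The default value `p.2` then leaves the
  -- factor `Fin k` untouched.
  ((ψ.equiv (p.1.up p.2)).down, (ψ.equiv (p.1.up p.2)).1.2.head?.getD p.2)

/-- Since flat nodes correspond to flat nodes, the default index is used in both directions or in
neither, which makes the two shifts inverse to each other. -/
theorem shift_symm_shift (ψ : S.NodeIso S' k D) (h : ∀ x, (ψ.equiv x).Flat ↔ x.Flat)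
    (p : S.Node k (D + 1) × Fin k) : ψ.symm.shift (ψ.shift p) = p := by
  obtain ⟨x, a⟩ := p
  have hy : ψ.symm.equiv ((ψ.shift (x, a)).1.up (ψ.shift (x, a)).2) = x.up a := by
    change ψ.equiv.symm ((ψ.equiv (x.up a)).down.up ((ψ.equiv (x.up a)).1.2.head?.getD a)) = _
    rw [Node.up_down, Equiv.symm_apply_apply]
  refine Prod.ext ?_ ?_
  · change (ψ.symm.equiv ((ψ.shift (x, a)).1.up (ψ.shift (x, a)).2)).down = x
    rw [hy, Node.down_up]
  · change (ψ.symm.equiv ((ψ.shift (x, a)).1.up (ψ.shift (x, a)).2)).1.2.head?.getD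
      ((ψ.equiv (x.up a)).1.2.head?.getD a) = a
    rw [hy]
    by_cases hf : (x.up a).Flat
    · have hf' := (h _).mpr hf
      rw [Node.Flat] at hf hf'
      rw [hf, hf']
      rfl
    · rw [Node.flat_up] at hf
      change (if S.dep x.1.1 ≤ D then [] else a :: x.1.2).head?.getD _ = a
      rw [if_neg hf]
      rfl

/-- The shift is a bijection of products with `Fin k`, to which cancellation applies. It is
compatible with parents only above depth `D`; the edges down to parents of depth at most `D` are cut
and remembered by labels instead. -/
theorem exists_succ [Finite V] [Finite V'] [NeZero k] (ψ : S.NodeIso S' k D)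
    (h : ∀ x, (ψ.equiv x).Flat ↔ x.Flat) : Nonempty (S.NodeIso S' k (D + 1)) := by
  classical
  have hs : ∀ x, (ψ.symm.equiv x).Flat ↔ x.Flat := by
    intro x
    rw [← h]
    change (ψ.equiv (ψ.equiv.symm x)).Flat ↔ _
    rw [Equiv.apply_symm_apply]
  let Ψ : S.Node k (D + 1) × Fin k ≃ S'.Node k (D + 1) × Fin k :=
    ⟨ψ.shift, ψ.symm.shift, ψ.shift_symm_shift h, ψ.symm.shift_symm_shift hs⟩
  let base (v : V) (hv : S.dep v ≤ D) : S.Node k D := ⟨(v, []), by simpa using by omega⟩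
  -- Nodes of depth at most `D` have one copy each, so `ψ` maps them to definite nodes. Using these
  -- images as labels for a node and for its parent restores the cut edges afterwards.
  let φ (v : V) : Option V' := if hv : S.dep v ≤ D then some (ψ.equiv (base v hv)).1.1 else none
  let φ' (v : V') : Option V' := if S'.dep v ≤ D then some v else none
  have hφ : ∀ y : S.Node k D, φ' (ψ.equiv y).1.1 = φ y.1.1 := by
    intro y
    have hy := h y
    rw [Node.flat_iff, Node.flat_iff] at hy
    by_cases hd : S.dep y.1.1 ≤ D
    · have hb : base y.1.1 hd = y := Node.ext' rfl (Node.flat_iff.mpr hd).symm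
      simp only [φ, φ', dif_pos hd, if_pos (hy.mpr hd), hb]
    · simp only [φ, φ', dif_neg hd, if_neg (mt hy.mp hd)]
  -- `ψ` may change the index of a node whose parent has none. There the index in `Fin k` would not
  -- be constant along the parent edge, so the operation is replaced by the identity.
  let a (i : Bool) (x : S.Node k (D + 1)) : S.Node k (D + 1) :=
    if i then x.prt else if S.dep (S.par x.1.1) ≤ D then x else x.par
  let b (i : Bool) (x : S'.Node k (D + 1)) : S'.Node k (D + 1) :=
    if i then x.prt else if S'.dep (S'.par x.1.1) ≤ D then x else x.par
  have hpar : ∀ y : S.Node k D, S'.dep (S'.par (ψ.equiv y).1.1) ≤ D ↔ S.dep (S.par y.1.1) ≤ D := by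
    intro y
    have := h y.par
    rw [ψ.map_par, Node.flat_iff, Node.flat_iff] at this
    exact this
  obtain ⟨θ, hθ, hθl⟩ := exists_equiv_of_prod_equiv a b
    (fun x => (S.lab x.1.1, min (S.dep x.1.1) (D + 1), φ x.1.1, φ (S.par x.1.1)))
    (fun x => (S'.lab x.1.1, min (S'.dep x.1.1) (D + 1), φ' x.1.1, φ' (S'.par x.1.1)))
    Ψ (by
      intro i x j
      rcases i with _ | _
      · change ψ.shift (if S.dep (S.par x.1.1) ≤ D then x else x.par, j) =
          (if S'.dep (S'.par (ψ.equiv (x.up j)).1.1) ≤ D then (ψ.equiv (x.up j)).down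
            else (ψ.equiv (x.up j)).down.par, (ψ.equiv (x.up j)).1.2.head?.getD j)
        have hp := hpar (x.up j)
        by_cases hd : S.dep (S.par x.1.1) ≤ D
        · rw [if_pos hd, if_pos (hp.mpr hd)]
          rfl
        · have hd' := mt hp.mp hd
          rw [if_neg hd, if_neg hd', shift]
          simp only [Node.up_par x j hd, ψ.map_par, Node.down_par _ hd', Node.head?_par _ hd']
      · change ((ψ.equiv (x.prt.up j)).down, (ψ.equiv (x.prt.up j)).1.2.head?.getD j) =
          ((ψ.equiv (x.up j)).prt.down, (ψ.equiv (x.up j)).prt.1.2.head?.getD j)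
        rw [Node.up_prt, ψ.map_prt]) (by
      intro x j
      have hl := ψ.map_lab (x.up j)
      have hm := ψ.map_dep (x.up j)
      have hf := h (x.up j)
      rw [Node.flat_iff, Node.flat_iff] at hf
      have h1 := hφ (x.up j)
      have h2 := hφ (x.up j).par
      rw [ψ.map_par] at h2
      refine Prod.ext hl (Prod.ext ?_ (Prod.ext h1 h2))
      change min (S'.dep (ψ.equiv (x.up j)).1.1) (D + 1) = min (S.dep (x.up j).1.1) (D + 1)
      -- Equal depths truncated at `D`, together with agreement on whether the depth is at most `D`,
      -- give equal depths truncated at `D + 1`.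
      omega)
  have hl : ∀ x, S'.lab (θ x).1.1 = S.lab x.1.1 := fun x => congrArg (fun q => q.1) (hθl x)
  have hm : ∀ x, min (S'.dep (θ x).1.1) (D + 1) = min (S.dep x.1.1) (D + 1) :=
    fun x => congrArg (fun q => q.2.1) (hθl x)
  have h1 : ∀ x, φ' (θ x).1.1 = φ x.1.1 := fun x => congrArg (fun q => q.2.2.1) (hθl x)
  have h2 : ∀ x, φ' (S'.par (θ x).1.1) = φ (S.par x.1.1) :=
    fun x => congrArg (fun q => q.2.2.2) (hθl x)
  refine ⟨θ, fun x => ?_, fun x => hθ true x, hl, hm⟩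
  by_cases hd : S.dep (S.par x.1.1) ≤ D
  · have h3 := (h1 x.par).trans (h2 x).symm
    have h4 := h2 x
    simp only [φ, dif_pos hd] at h4
    have h5 : S'.dep (S'.par (θ x).1.1) ≤ D := by
      by_contra hc
      simp [φ', if_neg hc] at h4
    have h6 : S'.dep (θ x.par).1.1 ≤ D := by
      by_contra hc
      simp [φ', if_neg hc, if_pos h5] at h3
    simp only [φ', if_pos h5, if_pos h6, Option.some.injEq] at h3
    exact Node.Flat.eq (Node.flat_iff.mpr (by omega))
      (Node.flat_iff.mpr (show S'.dep (S'.par (θ x).1.1) ≤ D + 1 by omega)) h3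
  · have h3 := hθ false x
    have h4 : ¬ S'.dep (S'.par (θ x).1.1) ≤ D := by
      intro hc
      have := h2 x
      simp [φ, φ', hc, hd] at this
    simp only [a, b, if_neg hd, if_neg h4, Bool.false_eq_true, if_false] at h3
    exact h3

end NodeIso

/-- Bounded forests are determined by their expansions. -/
theorem exists_equiv_of_nodeIso [Finite V] [Finite V'] [NeZero k] {Q : Set L} {δ : L → ℕ}
    (hS : S.IsBounded k Q δ) (hS' : S'.IsBounded k Q δ) (ψ : S.NodeIso S' k 0) :
    ∃ φ : V ≃ V', (∀ v, φ (S.par v) = S'.par (φ v)) ∧ (∀ v, φ (S.prt v) = S'.prt (φ v)) ∧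
      (∀ v, S'.lab (φ v) = S.lab v) ∧ ∀ v, S'.dep (φ v) = S.dep v := by
  classical
  have hall : ∀ D, Nonempty (S.NodeIso S' k D) := by
    intro D
    induction D with
    | zero => exact ⟨ψ⟩
    | succ D ih =>
      obtain ⟨χ⟩ := ih
      obtain ⟨χ', h⟩ := χ.exists_flat_iff hS hS'
      exact χ'.exists_succ h
  have := Fintype.ofFinite V
  have := Fintype.ofFinite V'
  -- At a level above all depths every node is flat, so the expansion is the forest and truncated
  -- depths are depths.
  let N := Finset.univ.sup S.dep + Finset.univ.sup S'.dep
  have hN : ∀ v, S.dep v ≤ N := fun v =>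
    (Finset.le_sup (f := S.dep) (Finset.mem_univ v)).trans (Nat.le_add_right _ _)
  have hN' : ∀ v, S'.dep v ≤ N := fun v =>
    (Finset.le_sup (f := S'.dep) (Finset.mem_univ v)).trans (Nat.le_add_left _ _)
  obtain ⟨χ⟩ := hall N
  let i (v : V) : S.Node k N := ⟨(v, []), by have := hN v; simp only [List.length_nil]; omega⟩
  let i' (v : V') : S'.Node k N := ⟨(v, []), by have := hN' v; simp only [List.length_nil]; omega⟩
  have hi : ∀ x : S.Node k N, i x.1.1 = x := fun x =>
    Node.Flat.eq rfl (Node.flat_iff.mpr (hN _)) rfl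
  have hi' : ∀ x : S'.Node k N, i' x.1.1 = x := fun x =>
    Node.Flat.eq rfl (Node.flat_iff.mpr (hN' _)) rfl
  have hp : ∀ v, i (S.par v) = (i v).par := fun v => hi (i v).par
  refine ⟨⟨fun v => (χ.equiv (i v)).1.1, fun v => (χ.equiv.symm (i' v)).1.1, fun v => ?_,
    fun v => ?_⟩, fun v => ?_, fun v => ?_, fun v => χ.map_lab (i v), fun v => ?_⟩
  · change (χ.equiv.symm (i' (χ.equiv (i v)).1.1)).1.1 = v
    rw [hi', Equiv.symm_apply_apply]
  · change (χ.equiv (i (χ.equiv.symm (i' v)).1.1)).1.1 = v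
    rw [hi, Equiv.apply_symm_apply]
  · change (χ.equiv (i (S.par v))).1.1 = _
    rw [hp, χ.map_par]
    rfl
  · change (χ.equiv (i v).prt).1.1 = _
    rw [χ.map_prt]
    rfl
  · have := χ.map_dep (i v)
    rw [min_eq_left (hN' _), min_eq_left (hN _)] at this
    exact this

end BoxForest
-- The forest of ports of a proof-structure
namespace PPLPS

variable {C P : Type*} {F : PPLPS C P}

theorem mem_aux {l : C} {p : P} : p ∈ F.aux l ↔ p ≠ F.pri l ∧ p ∈ F.ports l := by
  classical
  rw [Ports.aux, Finset.mem_erase]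

theorem aux_inj {l l' : C} {p : P} (h : p ∈ F.aux l) (h' : p ∈ F.aux l') : l = l' :=
  F.ports_inj _ _ _ (mem_aux.mp h).2 (mem_aux.mp h').2

theorem pri_inj {l l' : C} (h : F.pri l = F.pri l') : l = l' :=
  F.ports_inj _ _ _ (F.pri_mem l) (h ▸ F.pri_mem l')

theorem not_isPri_of_mem_aux {l : C} {p : P} (h : p ∈ F.aux l) : ¬ F.IsPri p := by
  rintro ⟨l', rfl⟩
  obtain ⟨h₁, h₂⟩ := mem_aux.mp h
  exact h₁ (congrArg F.pri (F.ports_inj _ _ _ (F.pri_mem l') h₂))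

theorem isAux_or_isPri {p : P} (h : F.IsCellPort p) : F.IsAux p ∨ F.IsPri p := by
  obtain ⟨l, h⟩ := h
  by_cases hp : p = F.pri l
  · exact .inr ⟨l, hp⟩
  · exact .inl ⟨l, mem_aux.mpr ⟨hp, h⟩⟩

theorem left_mem_aux {l : C} (h : F.IsMult l) : F.left l ∈ F.aux l :=
  mem_aux.mpr ⟨F.left_ne l h, F.left_mem l h⟩

theorem card_aux (l : C) : (F.aux l).card = F.arity l := by
  classical
  rw [Ports.aux, Finset.card_erase_of_mem (F.pri_mem l), F.ports_card, Nat.add_sub_cancel]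

/-- A port wired to a principal port is auxiliary. -/
theorem isAux_of_adj {p q : P} (h : F.wires.Adj p q) (hp : F.IsPri p) : F.IsAux q := by
  have hq : ¬ F.IsPri q := (F.wires_not_cut p q h).resolve_left (not_not.mpr hp)
  by_contra hc
  obtain ⟨p', hp', h'⟩ := F.wires_of_not_cellPort q fun h => (isAux_or_isPri h).elim hc hq
  exact hp' (F.wires_unique _ _ _ h.symm h' ▸ hp)

/-- Makes the order on ports a forest: an auxiliary port lies only above the principal port of its
cell, a principal port only above the port at the other end of its wire. -/
theorem Below.unique {x y p : P} (hx : F.Below x p) (hy : F.Below y p) : x = y := by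
  rcases hx with ⟨l, rfl, hl⟩ | ⟨hp, hx, h⟩ <;> rcases hy with ⟨l', rfl, hl'⟩ | ⟨hp', hy, h'⟩
  · rw [aux_inj hl hl']
  · exact absurd hp' (not_isPri_of_mem_aux hl)
  · exact absurd hp (not_isPri_of_mem_aux hl')
  · exact F.wires_unique _ _ _ h.symm h'.symm

theorem Below.ne {x p : P} (h : F.Below x p) : x ≠ p := by
  rintro rfl
  rcases h with ⟨l, h, hl⟩ | ⟨hp, hx, h⟩
  · exact (mem_aux.mp hl).1 h
  · exact F.wires.irrefl h

open scoped Classical in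
variable (F) in
/-- The port immediately below `p`, or `p` itself for a conclusion. -/
noncomputable def par (p : P) : P := if h : ∃ x, F.Below x p then h.choose else p

theorem Below.par_eq {x p : P} (h : F.Below x p) : F.par p = x := by
  have h' : ∃ x, F.Below x p := ⟨x, h⟩
  rw [par, dif_pos h']
  exact h'.choose_spec.unique h

theorem below_par {p : P} (h : F.par p ≠ p) : F.Below (F.par p) p := by
  by_cases h' : ∃ x, F.Below x p
  · obtain ⟨x, hx⟩ := h'
    rwa [hx.par_eq]
  · exact absurd (dif_neg h') h

theorem below_iff {x p : P} : F.Below x p ↔ F.par p = x ∧ p ≠ x :=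
  ⟨fun h => ⟨h.par_eq, h.ne.symm⟩, by rintro ⟨rfl, h⟩; exact below_par h.symm⟩

theorem mem_aux_iff {l : C} {p : P} : p ∈ F.aux l ↔ F.par p = F.pri l ∧ p ≠ F.pri l := by
  rw [← below_iff]
  refine ⟨fun h => .inl ⟨l, rfl, h⟩, ?_⟩
  rintro (⟨l', h, hl'⟩ | ⟨-, ⟨l', h⟩, -⟩)
  · rwa [pri_inj h]
  · exact absurd ⟨l, rfl⟩ (not_isPri_of_mem_aux h)

/-- A cell port on a wire always has a port below it. For a wired principal port this uses that the
other end is auxiliary. -/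
theorem par_eq_self_iff {p : P} : F.par p = p ↔ p ∈ F.conclusions := by
  rw [← not_iff_not, conclusions, Set.mem_ofPred_eq, not_not]
  constructor
  · intro h
    rcases below_par h with ⟨l, -, hl⟩ | ⟨⟨l, hl⟩, -, h⟩
    · exact ⟨⟨l, (mem_aux.mp hl).2⟩, F.wires_of_not_pri p (not_isPri_of_mem_aux hl)⟩
    · exact ⟨⟨l, hl ▸ F.pri_mem l⟩, _, h.symm⟩
  · rintro ⟨h, q, hq⟩
    rcases isAux_or_isPri h with ⟨l, hl⟩ | hp
    · rw [(mem_aux_iff.mp hl).1]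
      exact (mem_aux_iff.mp hl).2.symm
    · have : F.Below q p := .inr ⟨hp, isAux_of_adj hq hp, hq.symm⟩
      rw [this.par_eq]
      exact this.ne

theorem le_iff {x p : P} : F.Le x p ↔ x = p ∨ F.par p ≠ p ∧ F.Le x (F.par p) := by
  constructor
  · intro h
    rcases Relation.ReflTransGen.cases_tail h with h | ⟨y, hy, h⟩
    · exact .inl h.symm
    · right
      rw [h.par_eq]
      exact ⟨h.ne, hy⟩
  · rintro (rfl | ⟨h, h'⟩)
    · exact .refl
    · exact h'.tail (below_par h)

/-- The number of ports below a port serves as height; antisymmetry makes it increase strictly. -/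
theorem exists_height [Finite P] (hF : F.IsPLPS) :
    ∃ h : P → ℕ, ∀ p, F.par p ≠ p → h (F.par p) < h p := by
  refine ⟨fun p => {x | F.Le x p}.ncard, fun p hp => Set.ncard_lt_ncard ⟨?_, ?_⟩ (Set.toFinite _)⟩
  · exact fun x hx => le_iff.mpr (.inr ⟨hp, hx⟩)
  · intro h
    exact hp (hF _ _ (Relation.ReflTransGen.single (below_par hp)) (h (.refl : F.Le p p)))

variable (F) in
/-- The difference of depth between an auxiliary port and the principal port of its cell. -/
noncomputable def weight (l : C) (p : P) : ℕ :=
  match F.type l with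
  | .bang => 1
  | .quest => F.num p
  | _ => 0

section Depth

variable [Fintype C] [Fintype P]

theorem depth_of_par_eq_self {p : P} (h : F.par p = p) : F.depth p = 0 := by
  classical
  have hle : ∀ x, F.Le x p ↔ x = p := fun x => by rw [le_iff]; simp [h]
  rw [depth, Nat.add_eq_zero_iff, Finset.card_eq_zero, Finset.filter_eq_empty_iff]
  refine ⟨fun l _ hl => hl.2.2 ((hle _).mp hl.2.1), Finset.sum_eq_zero fun q hq => ?_⟩
  obtain ⟨-, ⟨l, -, hl⟩, hq⟩ := Finset.mem_filter.mp hq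
  rw [hle] at hq
  subst hq
  exact absurd (h.symm.trans (mem_aux_iff.mp hl).1) (mem_aux.mp hl).1

/-- Passing from `q` up to `p` adds only `p` to the ports below. As a principal port it is not
auxiliary, and the condition of being strictly below excludes it from the count of `!`-cells. -/
theorem depth_of_adj (hF : F.IsPLPS) {p q : P} (h : F.wires.Adj p q) (hp : F.IsPri p) :
    F.depth p = F.depth q := by
  classical
  obtain ⟨l, hl⟩ := isAux_of_adj h hp
  have hb : F.Below q p := .inr ⟨hp, ⟨l, hl⟩, h.symm⟩
  have hle : ∀ x, F.Le x p ↔ x = p ∨ F.Le x q := fun x => by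
    rw [le_iff, hb.par_eq]
    simp [hb.ne]
  have hne : ¬ F.Le p q := fun hc => hb.ne (hF _ _ (.single hb) hc)
  rw [depth, depth]
  congr 2
  · ext l'
    simp only [Finset.mem_filter, Finset.mem_univ, true_and, hle]
    refine and_congr_right fun _ => ⟨fun ⟨h₁, h₂⟩ => ⟨h₁.resolve_left h₂, ?_⟩, fun ⟨h₁, h₂⟩ =>
      ⟨.inr h₁, ?_⟩⟩
    · exact fun hc => not_isPri_of_mem_aux hl ⟨l', hc.symm⟩
    · exact fun hc => hne (hc ▸ h₁)
  · ext x
    simp only [Finset.mem_filter, Finset.mem_univ, true_and, hle]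
    refine and_congr_right fun ⟨l', _, hx⟩ => ⟨fun h => h.resolve_left fun hc => ?_, .inr⟩
    exact not_isPri_of_mem_aux hx (hc ▸ hp)

/-- Above `F.pri l` two things can start to count: the cell `l` itself if it is a `!`-cell, whose
principal port is now strictly below, and `p` itself if `l` is a `?`-cell. -/
theorem depth_of_mem_aux (hF : F.IsPLPS) {l : C} {p : P} (h : p ∈ F.aux l) :
    F.depth p = F.depth (F.pri l) + F.weight l p := by
  classical
  have hb : F.Below (F.pri l) p := .inl ⟨l, rfl, h⟩
  have hle : ∀ x, F.Le x p ↔ x = p ∨ F.Le x (F.pri l) := fun x => by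
    rw [le_iff, hb.par_eq]
    simp [hb.ne]
  have hne : ¬ F.Le p (F.pri l) := fun hc => hb.ne (hF _ _ (.single hb) hc)
  have h1 : (Finset.univ.filter fun l' => F.type l' = .bang ∧ F.Le (F.pri l') p ∧ F.pri l' ≠ p).card
      = (Finset.univ.filter fun l' => F.type l' = .bang ∧ F.Le (F.pri l') (F.pri l) ∧
          F.pri l' ≠ F.pri l).card + if F.type l = .bang then 1 else 0 := by
    have : (if F.type l = .bang then 1 else 0) =
        (Finset.univ.filter fun l' => F.type l' = .bang ∧ l' = l).card := by
      split_ifs with hl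
      · rw [eq_comm, Finset.card_eq_one]
        refine ⟨l, ?_⟩
        ext l'
        simp only [Finset.mem_filter, Finset.mem_univ, true_and, Finset.mem_singleton]
        exact ⟨And.right, fun h => ⟨h ▸ hl, h⟩⟩
      · rw [eq_comm, Finset.card_eq_zero, Finset.filter_eq_empty_iff]
        rintro l' - ⟨h₁, rfl⟩
        exact hl h₁
    rw [this, ← Finset.card_union_of_disjoint]
    · congr 1
      ext l'
      simp only [Finset.mem_filter, Finset.mem_union, Finset.mem_univ, true_and, hle]
      have h₁ : F.pri l' ≠ p := fun hc => not_isPri_of_mem_aux h ⟨l', hc.symm⟩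
      have h₂ : F.pri l' = F.pri l ↔ l' = l := ⟨pri_inj, congrArg _⟩
      have h₃ : l' = l → F.Le (F.pri l') (F.pri l) := fun h => h ▸ .refl
      tauto
    · refine Finset.disjoint_left.mpr fun l' h₁ h₂ => ?_
      simp only [Finset.mem_filter] at h₁ h₂
      exact h₁.2.2.2 (congrArg _ h₂.2.2)
  have h2 : ∑ q ∈ Finset.univ.filter (fun q => F.IsQuestAux q ∧ F.Le q p), F.num q =
      ∑ q ∈ Finset.univ.filter (fun q => F.IsQuestAux q ∧ F.Le q (F.pri l)), F.num q +
        if F.type l = .quest then F.num p else 0 := by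
    split_ifs with hl
    · have : Finset.univ.filter (fun q => F.IsQuestAux q ∧ F.Le q p) =
          insert p (Finset.univ.filter fun q => F.IsQuestAux q ∧ F.Le q (F.pri l)) := by
        ext x
        simp only [Finset.mem_filter, Finset.mem_univ, true_and, hle, Finset.mem_insert]
        have : x = p → F.IsQuestAux x := by rintro rfl; exact ⟨l, hl, h⟩
        tauto
      rw [this, Finset.sum_insert (by simp [hne]), add_comm]
    · rw [add_zero]
      congr 1
      ext x
      simp only [Finset.mem_filter, Finset.mem_univ, true_and, hle]
      refine and_congr_right fun ⟨l', hl', hx⟩ => ⟨fun h' => h'.resolve_left ?_, .inr⟩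
      rintro rfl
      exact hl (aux_inj h hx ▸ hl')
  rw [depth, depth, h1, h2, weight]
  cases F.type l <;> simp <;> omega

end Depth

open scoped Classical in
variable (F) in
/-- The other port of an axiom; all other ports are fixed. -/
noncomputable def prt (p : P) : P := if h : ∃ q, F.AxWire p q then h.choose else p

theorem AxWire.symm {p q : P} (h : F.AxWire p q) : F.AxWire q p := ⟨h.1.symm, h.2.2, h.2.1⟩

theorem AxWire.prt_eq {p q : P} (h : F.AxWire p q) : F.prt p = q := by
  have h' : ∃ q, F.AxWire p q := ⟨q, h⟩
  rw [prt, dif_pos h']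
  exact F.wires_unique _ _ _ h'.choose_spec.1 h.1

theorem axWire_prt {p : P} (h : F.prt p ≠ p) : F.AxWire p (F.prt p) := by
  by_cases h' : ∃ q, F.AxWire p q
  · obtain ⟨q, hq⟩ := h'
    rwa [hq.prt_eq]
  · exact absurd (dif_neg h') h

theorem AxWire.ne {p q : P} (h : F.AxWire p q) : p ≠ q := F.wires.ne_of_adj h.1

theorem axWire_iff {p q : P} : F.AxWire p q ↔ F.prt p = q ∧ q ≠ p :=
  ⟨fun h => ⟨h.prt_eq, h.ne.symm⟩, by rintro ⟨rfl, h⟩; exact axWire_prt h⟩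

/-- A port that is not principal is on an axiom or wired to a principal port. -/
theorem axWire_or_of_not_isPri {p : P} (h : ¬ F.IsPri p) :
    (∃ q, F.AxWire p q) ∨ ∃ l, F.wires.Adj p (F.pri l) := by
  obtain ⟨q, hq⟩ := F.wires_of_not_pri p h
  by_cases h' : F.IsPri q
  · obtain ⟨l, rfl⟩ := h'
    exact .inr ⟨l, hq⟩
  · exact .inl ⟨q, hq, h, h'⟩

/-- The labels of ports: index of a conclusion, type of the cell of a principal port, type of the
cell of an auxiliary port and whether it is the left one. -/
abbrev PortLabel : Type := Option ℕ × Option CellType × Option (CellType × Bool)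

open scoped Classical in
variable (F) in
/-- The type of the cell of a principal port. -/
noncomputable def priType (p : P) : Option CellType :=
  if h : F.IsPri p then some (F.type h.choose) else none

theorem priType_pri (l : C) : F.priType (F.pri l) = some (F.type l) := by
  have h : F.IsPri (F.pri l) := ⟨l, rfl⟩
  rw [priType, dif_pos h, ← pri_inj h.choose_spec]

theorem priType_eq_none {p : P} : F.priType p = none ↔ ¬ F.IsPri p := by
  unfold priType
  split_ifs with h <;> simp [h]

open scoped Classical in
variable (F) in
/-- The type of the cell of an auxiliary port, and whether the port is the left one. -/
noncomputable def auxType (p : P) : Option (CellType × Bool) :=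
  if h : F.IsAux p then
    some (F.type h.choose, decide (F.IsMult h.choose ∧ p = F.left h.choose)) else none

open scoped Classical in
theorem auxType_of_mem {l : C} {p : P} (h : p ∈ F.aux l) :
    F.auxType p = some (F.type l, decide (F.IsMult l ∧ p = F.left l)) := by
  have h' : F.IsAux p := ⟨l, h⟩
  rw [auxType, dif_pos h', aux_inj h'.choose_spec h]

theorem auxType_eq_none {p : P} : F.auxType p = none ↔ ¬ F.IsAux p := by
  unfold auxType
  split_ifs with h <;> simp [h]

open scoped Classical in
/-- The index of a conclusion. -/
noncomputable def Indexing.index (ind : F.Indexing) (p : P) : Option ℕ :=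
  if h : p ∈ F.conclusions then some (ind ⟨p, h⟩) else none

theorem Indexing.index_of_mem (ind : F.Indexing) {p : P} (h : p ∈ F.conclusions) :
    ind.index p = some (ind ⟨p, h⟩ : ℕ) := dif_pos h

theorem Indexing.index_eq_none (ind : F.Indexing) {p : P} :
    ind.index p = none ↔ p ∉ F.conclusions := by
  unfold Indexing.index
  split_ifs with h <;> simp [h]

/-- The forest of the ports of a linear proof-structure. -/
noncomputable def Indexing.forest [Fintype C] [Fintype P] (ind : F.Indexing) (hF : F.IsLPS) :
    BoxForest P PortLabel where
  par := F.par
  prt := F.prt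
  lab p := (ind.index p, F.priType p, F.auxType p)
  dep := F.depth
  dep_par p := by
    by_cases h : F.par p = p
    · rw [h]
    rcases below_par h with ⟨l, hl, h⟩ | ⟨hp, -, h⟩
    · rw [hl, depth_of_mem_aux hF.isPLPS h]
      exact Nat.le_add_right _ _
    · rw [depth_of_adj hF.isPLPS h.symm hp]
  dep_prt p := by
    by_cases h : F.prt p = p
    · rw [h]
    · exact (hF.depth_eq _ _ (axWire_prt h)).symm
  dep_root _ := depth_of_par_eq_self
  exists_height := exists_height hF.isPLPS

/-- The relative depth determined by the label of a port that is not an auxiliary port of a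
`?`-cell. -/
def labelWeight : PortLabel → ℕ
  | (_, _, some (.bang, _)) => 1
  | _ => 0

/-- The siblings of an auxiliary port of a `?`-cell are the auxiliary ports of that cell, so the
hypothesis on `k` bounds their number. Only for these ports is the relative depth, here `num`,
absent from the label. -/
theorem Indexing.forest_isBounded [Fintype C] [Fintype P] (ind : F.Indexing) (hF : F.IsLPS)
    {k : ℕ} (hk : F.cosize < k) :
    (ind.forest hF).IsBounded k {x | x.2.2.map Prod.fst = some .quest} labelWeight where
  card_lt p hp hQ := by
    classical
    have hQ : (F.auxType p).map Prod.fst = some CellType.quest := hQ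
    have ha : F.IsAux p := by
      by_contra h
      rw [auxType_eq_none.mpr h] at hQ
      cases hQ
    obtain ⟨l, hl⟩ := ha
    rw [auxType_of_mem hl] at hQ
    have hq : F.type l = .quest := Option.some.inj hQ
    have hs : {w | F.par w = F.par p ∧ w ≠ F.par p} = (F.aux l : Set P) := by
      ext w
      rw [(mem_aux_iff.mp hl).1]
      exact mem_aux_iff.symm
    change {w | F.par w = F.par p ∧ w ≠ F.par p}.ncard < k
    rw [hs, Set.ncard_coe_finset, card_aux]
    refine lt_of_le_of_lt ?_ hk
    exact Finset.le_sup (f := F.arity) (Finset.mem_filter.mpr ⟨Finset.mem_univ l, hq⟩)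
  dep_eq p hp hQ := by
    have hQ : ¬ (F.auxType p).map Prod.fst = some CellType.quest := hQ
    change F.depth p = F.depth (F.par p) + labelWeight (ind.index p, F.priType p, F.auxType p)
    rcases below_par hp with ⟨l, hl, h⟩ | ⟨hpp, -, h⟩
    · rw [hl, depth_of_mem_aux hF.isPLPS h, weight]
      rw [auxType_of_mem h] at hQ ⊢
      cases ht : F.type l <;> simp [ht, labelWeight] at hQ ⊢
    · rw [auxType_eq_none.mpr fun ⟨l, hl⟩ => not_isPri_of_mem_aux hl hpp]
      exact depth_of_adj hF.isPLPS h.symm hpp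

end PPLPS
-- From bijections of ports to isomorphisms of structures
namespace PPLPS

variable {C P C' P' : Type*} {F : PPLPS C P} {F' : PPLPS C' P'}

/-- Every wire is an axiom or joins a principal port to its parent, so parents, partners and the set
of principal ports determine the wires. -/
theorem adj_iff {p q : P} : F.wires.Adj p q ↔ (F.prt p = q ∧ q ≠ p) ∨
    (F.IsPri p ∧ F.par p = q ∧ p ≠ q) ∨ (F.IsPri q ∧ F.par q = p ∧ q ≠ p) := by
  constructor
  · intro h
    by_cases hp : F.IsPri p
    · exact .inr (.inl ⟨hp, below_iff.mp (.inr ⟨hp, isAux_of_adj h hp, h.symm⟩)⟩)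
    by_cases hq : F.IsPri q
    · exact .inr (.inr ⟨hq, below_iff.mp (.inr ⟨hq, isAux_of_adj h.symm hq, h⟩)⟩)
    · exact .inl (axWire_iff.mp ⟨h, hp, hq⟩)
  · have key : ∀ {p q}, F.IsPri p → F.par p = q ∧ p ≠ q → F.wires.Adj q p := by
      intro p q hp h
      rcases below_iff.mpr h with ⟨l, -, hl⟩ | ⟨-, -, h⟩
      · exact absurd hp (not_isPri_of_mem_aux hl)
      · exact h
    rintro (h | ⟨hp, h⟩ | ⟨hq, h⟩)
    · exact (axWire_iff.mpr h).1
    · exact (key hp h).symm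
    · exact key hq h

/-- Bijections of the ports that preserve the positions of the ports in the structures. -/
structure PortEquiv (ind : F.Indexing) (ind' : F'.Indexing) [Fintype C] [Fintype P] [Fintype C']
    [Fintype P'] (φ : P ≃ P') : Prop where
  par : ∀ p, φ (F.par p) = F'.par (φ p)
  prt : ∀ p, φ (F.prt p) = F'.prt (φ p)
  index : ∀ p, ind'.index (φ p) = ind.index p
  priType : ∀ p, F'.priType (φ p) = F.priType p
  auxType : ∀ p, F'.auxType (φ p) = F.auxType p
  depth : ∀ p, F'.depth (φ p) = F.depth p

namespace PortEquiv

variable [Fintype C] [Fintype P] [Fintype C'] [Fintype P'] {ind : F.Indexing}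
  {ind' : F'.Indexing} {φ : P ≃ P'}

theorem symm (h : PortEquiv ind ind' φ) : PortEquiv ind' ind φ.symm where
  par p := by rw [Equiv.symm_apply_eq, h.par, Equiv.apply_symm_apply]
  prt p := by rw [Equiv.symm_apply_eq, h.prt, Equiv.apply_symm_apply]
  index p := by rw [← h.index, Equiv.apply_symm_apply]
  priType p := by rw [← h.priType, Equiv.apply_symm_apply]
  auxType p := by rw [← h.auxType, Equiv.apply_symm_apply]
  depth p := by rw [← h.depth, Equiv.apply_symm_apply]

theorem isPri_iff (h : PortEquiv ind ind' φ) (p : P) : F'.IsPri (φ p) ↔ F.IsPri p := by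
  rw [← not_iff_not, ← priType_eq_none, ← priType_eq_none, h.priType]

theorem exists_cell (h : PortEquiv ind ind' φ) (l : C) : ∃ l', φ (F.pri l) = F'.pri l' :=
  (h.isPri_iff _).mpr ⟨l, rfl⟩

theorem conclusions_iff (h : PortEquiv ind ind' φ) (p : P) :
    φ p ∈ F'.conclusions ↔ p ∈ F.conclusions := by
  rw [← not_iff_not, ← ind'.index_eq_none, ← ind.index_eq_none, h.index]

theorem adj_iff (h : PortEquiv ind ind' φ) (p q : P) :
    F'.wires.Adj (φ p) (φ q) ↔ F.wires.Adj p q := by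
  rw [PPLPS.adj_iff, PPLPS.adj_iff, h.isPri_iff, h.isPri_iff, ← h.prt, ← h.par, ← h.par]
  simp only [EmbeddingLike.apply_eq_iff_eq, ne_eq]

/-- The induced bijection on the cells. -/
noncomputable def cell (h : PortEquiv ind ind' φ) : C ≃ C' where
  toFun l := (h.exists_cell l).choose
  invFun l := (h.symm.exists_cell l).choose
  left_inv l := pri_inj (by
    rw [← (h.symm.exists_cell _).choose_spec, ← (h.exists_cell _).choose_spec,
      Equiv.symm_apply_apply])
  right_inv l := pri_inj (by
    rw [← (h.exists_cell _).choose_spec, ← (h.symm.exists_cell _).choose_spec,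
      Equiv.apply_symm_apply])

theorem pri_cell (h : PortEquiv ind ind' φ) (l : C) : F'.pri (h.cell l) = φ (F.pri l) :=
  (h.exists_cell l).choose_spec.symm

theorem mem_aux_iff (h : PortEquiv ind ind' φ) (l : C) (p : P) :
    φ p ∈ F'.aux (h.cell l) ↔ p ∈ F.aux l := by
  rw [PPLPS.mem_aux_iff, PPLPS.mem_aux_iff, ← h.par, pri_cell]
  simp only [EmbeddingLike.apply_eq_iff_eq, ne_eq]

theorem aux_cell (h : PortEquiv ind ind' φ) (l : C) :
    F'.aux (h.cell l) = (F.aux l).map φ.toEmbedding := by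
  ext p
  rw [Finset.mem_map_equiv, ← h.mem_aux_iff, Equiv.apply_symm_apply]

theorem type_cell (h : PortEquiv ind ind' φ) (l : C) : F'.type (h.cell l) = F.type l := by
  have := h.priType (F.pri l)
  rw [← h.pri_cell, priType_pri, priType_pri] at this
  exact Option.some.inj this

theorem isMult_cell (h : PortEquiv ind ind' φ) (l : C) : F'.IsMult (h.cell l) ↔ F.IsMult l := by
  rw [Cells.IsMult, Cells.IsMult, h.type_cell]

theorem left_cell (h : PortEquiv ind ind' φ) {l : C} (hl : F.IsMult l) :
    F'.left (h.cell l) = φ (F.left l) := by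
  have h1 := h.auxType (F.left l)
  have h2 := (h.mem_aux_iff l _).mpr (left_mem_aux hl)
  rw [auxType_of_mem (left_mem_aux hl), auxType_of_mem h2] at h1
  have h3 := congrArg Prod.snd (Option.some.inj h1)
  simp only [decide_eq_decide] at h3
  exact (h3.mpr ⟨hl, trivial⟩).2.symm

/-- Labels do not mention `num`; the preserved depths of an auxiliary port and of its principal port
recover it. -/
theorem weight_cell (h : PortEquiv ind ind' φ) (hF : F.IsPLPS) (hF' : F'.IsPLPS) {l : C} {p : P}
    (hp : p ∈ F.aux l) : F'.weight (h.cell l) (φ p) = F.weight l p := by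
  have h1 := depth_of_mem_aux hF hp
  have h2 := depth_of_mem_aux hF' ((h.mem_aux_iff l p).mpr hp)
  rw [h.pri_cell, h.depth, h.depth] at h2
  omega

/-- The induced isomorphism of indexed structures. -/
noncomputable def indIso (h : PortEquiv ind ind' φ) (hF : F.IsPLPS) (hF' : F'.IsPLPS) :
    IndIso ind ind' where
  cell := h.cell
  port := φ
  type_eq := h.type_cell
  arity_eq l := by rw [← card_aux, ← card_aux, h.aux_cell, Finset.card_map]
  ports_iff l p := by
    by_cases hp : p = F.pri l
    · rw [hp, ← h.pri_cell]
      exact iff_of_true (F'.pri_mem _) (F.pri_mem _)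
    · have := h.mem_aux_iff l p
      rw [mem_aux, mem_aux, h.pri_cell] at this
      simpa [hp] using this
  pri_eq := h.pri_cell
  left_eq _ := h.left_cell
  num_eq := by
    rintro p ⟨l, hl, hp⟩
    have := h.weight_cell hF hF' hp
    rwa [weight, weight, h.type_cell, hl] at this
  wires_iff := h.adj_iff
  ind_eq c := by
    refine ⟨(h.conclusions_iff _).mpr c.2, ?_⟩
    have := h.index c
    rw [ind'.index_of_mem ((h.conclusions_iff _).mpr c.2), ind.index_of_mem c.2] at this
    exact Option.some.inj this

end PortEquiv
end PPLPS

/-! ### Injectivity of the constructors of points -/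

namespace Point

variable {X Y Z : Type*}

theorem map_map (g : Y → Z) (f : X → Y) (a : Point X) : map g (map f a) = map (g ∘ f) a := by
  refine Quotient.inductionOn a fun a => congrArg (Quotient.mk _) ?_
  induction a with
  | atom x => rfl
  | star i => rfl
  | pair i a b ha hb => simp only [PrePoint.map, ha, hb]
  | bag i n f ih => simp only [PrePoint.map, ih]

theorem atoms_map (f : X → Y) (a : Point X) : (map f a).atoms = f '' a.atoms := by
  refine Quotient.inductionOn a fun a => ?_
  change (a.map f).atoms = f '' a.atoms
  induction a with
  | atom x => simp [PrePoint.map, PrePoint.atoms]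
  | star i => simp [PrePoint.map, PrePoint.atoms]
  | pair i a b ha hb => simp [PrePoint.map, PrePoint.atoms, ha, hb, Set.image_union]
  | bag i n f ih => simp [PrePoint.map, PrePoint.atoms, ih, Set.image_iUnion]

theorem mem_atoms_bag {i : Polarity} {a : Multiset (Point X)} {d : X} :
    d ∈ (bag i a).atoms ↔ ∃ x ∈ a, d ∈ atoms x := by simp [atoms_bag]

theorem atom_injective : Function.Injective (atom : X → Point X) := by
  intro x y h
  have := Quotient.exact h
  cases this
  rfl

theorem pair_inj {i j : Polarity} {a b c d : Point X} (h : pair i a b = pair j c d) :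
    i = j ∧ a = c ∧ b = d := by
  revert h
  refine Quotient.inductionOn₂ a b fun a b => Quotient.inductionOn₂ c d fun c d h => ?_
  have := Quotient.exact h
  cases this with
  | pair _ h₁ h₂ => exact ⟨rfl, Quotient.sound h₁, Quotient.sound h₂⟩

theorem bag_inj {i j : Polarity} {a b : Multiset (Point X)} (h : bag i a = bag j b) :
    i = j ∧ a = b := by
  have := Quotient.exact h
  cases this with
  | bag _ s h =>
    refine ⟨rfl, ?_⟩
    rw [← map_get_toList a, ← map_get_toList b]
    have h' : a.toList.get = b.toList.get ∘ s := by
      funext x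
      rw [← Quotient.out_eq (a.toList.get x)]
      change _ = b.toList.get (s x)
      rw [← Quotient.out_eq (b.toList.get (s x))]
      exact Quotient.sound (h x)
    rw [h', ← Multiset.map_map]
    congr 1
    exact congrArg Finset.val (Finset.map_univ_equiv s)

end Point
-- Experiments and transport of labels along a bijection of ports
/-- The polarity of the labels of the principal ports of the cells of a given type. -/
def CellType.polarity : CellType → Polarity
  | .tens => .pos
  | .parr => .neg
  | .one => .pos
  | .bot => .neg
  | .bang => .pos
  | .quest => .neg

namespace PPLPS

variable {A C P C' P' : Type*} {F : PPLPS C P} {F' : PPLPS C' P'} {k : ℕ} {e : P → IPoint A}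
  {e' : P' → IPoint A}

theorem isRight_unique {l : C} (h : F.IsMult l) : ∃! q, F.IsRight l q := by
  classical
  have hc : ((F.aux l).erase (F.left l)).card = 1 := by
    rw [Finset.card_erase_of_mem (left_mem_aux h), card_aux]
    rcases h with h | h
    · rw [F.arity_tens l h]
    · rw [F.arity_parr l h]
  obtain ⟨q, hq⟩ := Finset.card_eq_one.mp hc
  have key : ∀ q', F.IsRight l q' ↔ q' = q := fun q' => by
    rw [Ports.IsRight, and_comm, ← Finset.mem_erase, hq, Finset.mem_singleton]
  exact ⟨q, (key q).mpr rfl, fun q' h => (key q').mp h⟩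

theorem aux_eq_empty {l : C} (h : F.type l = .one ∨ F.type l = .bot) : F.aux l = ∅ := by
  rw [← Finset.card_eq_zero, card_aux]
  exact h.elim (F.arity_one l) (F.arity_bot l)

namespace IsExperiment

/-- With polarities and `weight`, the six cell types reduce to three cases: binary, nullary and
exponential. -/
theorem pair (he : F.IsExperiment k e) {l : C} (h : F.IsMult l) {q : P} (hq : F.IsRight l q) :
    e (F.pri l) = .pair (F.type l).polarity (e (F.left l)) (e q) := by
  rcases h with h | h
  · rw [he.tens l h q hq, h]; rfl
  · rw [he.parr l h q hq, h]; rfl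

theorem star (he : F.IsExperiment k e) {l : C} (h : F.type l = .one ∨ F.type l = .bot) :
    e (F.pri l) = .star (F.type l).polarity := by
  rcases h with h | h
  · rw [he.one l h, h]; rfl
  · rw [he.bot l h, h]; rfl

theorem bag (he : F.IsExperiment k e) {l : C} (h : F.type l = .bang ∨ F.type l = .quest) :
    e (F.pri l) =
      .bag (F.type l).polarity (∑ p ∈ F.aux l, digBag k (F.weight l p) {e p}) := by
  unfold weight
  rcases h with h | h
  · rw [he.bang l h, h]; rfl
  · rw [he.quest l h, h]; rfl

end IsExperiment

theorem type_cases (l : C) : F.IsMult l ∨ (F.type l = .one ∨ F.type l = .bot) ∨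
    (F.type l = .bang ∨ F.type l = .quest) := by
  rw [Cells.IsMult]
  cases F.type l <;> simp

theorem mem_digBag {d : ℕ} {a b : IPoint A} : b ∈ digBag k d {a} ↔
    ∃ s : Fin d → Fin k, b = a.map (dig (List.ofFn fun i => (s i : ℕ) + 1)) := by
  simp [digBag, Multiset.mem_sum]

/-- Induction from the leaves to the conclusions. -/
theorem IsPLPS.induction [Finite P] (hF : F.IsPLPS) {Q : P → Prop}
    (h : ∀ p, (∀ c, F.par c = p → c ≠ p → Q c) → Q p) (p : P) : Q p := by
  classical
  have := Fintype.ofFinite P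
  obtain ⟨ht, hht⟩ := exists_height hF
  have hle : ∀ p, ht p ≤ Finset.univ.sup ht := fun p => Finset.le_sup (Finset.mem_univ p)
  -- Children have greater height, so the distance to the maximal height decreases.
  induction hn : Finset.univ.sup ht - ht p using Nat.strong_induction_on generalizing p with
  | _ n ih =>
    refine h p fun c hc hne => ih _ ?_ c rfl
    have h₁ := hht c (by rw [hc]; exact hne.symm)
    have h₂ := hle c
    rw [hc] at h₁
    omega

theorem exists_pequiv {α β : Type*} (R : α → β → Prop)
    (h₁ : ∀ a b b', R a b → R a b' → b = b') (h₂ : ∀ a a' b, R a b → R a' b → a = a') :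
    ∃ t : α ≃. β, ∀ a b, t a = some b ↔ R a b := by
  classical
  let f (a : α) : Option β := if h : ∃ b, R a b then some h.choose else none
  let g (b : β) : Option α := if h : ∃ a, R a b then some h.choose else none
  have hf : ∀ a b, f a = some b ↔ R a b := by
    intro a b
    by_cases h : ∃ b, R a b
    · simp only [f, dif_pos h, Option.some.injEq]
      exact ⟨fun h' => h' ▸ h.choose_spec, fun h' => h₁ _ _ _ h.choose_spec h'⟩
    · simp only [f, dif_neg h]
      exact ⟨fun h' => by simp at h', fun h' => absurd ⟨b, h'⟩ h⟩
  have hg : ∀ a b, g b = some a ↔ R a b := by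
    intro a b
    by_cases h : ∃ a, R a b
    · simp only [g, dif_pos h, Option.some.injEq]
      exact ⟨fun h' => h' ▸ h.choose_spec, fun h' => h₂ _ _ _ h.choose_spec h'⟩
    · simp only [g, dif_neg h]
      exact ⟨fun h' => by simp at h', fun h' => absurd ⟨a, h'⟩ h⟩
  exact ⟨⟨f, g, fun a b => (hg a b).trans (hf a b).symm⟩, hf⟩

/-- In atomic experiments the two ports of an axiom carry the same atom. -/
theorem IsExperiment.exists_atom (he : F.IsExperiment k e) (hat : F.IsAtomic e) {p q : P}
    (h : F.AxWire p q) : ∃ g : A, e p = Point.atom (g, []) ∧ e q = Point.atom (g, []) := by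
  obtain ⟨g, hg⟩ := hat q p h.symm
  refine ⟨g, ?_, hg⟩
  rw [(he.axWire p q h).1, hg]
  rfl

theorem IsInjective.eq_or_eq (hinj : F.IsInjective e) {p q p' q' : P} (h : F.AxWire p q)
    (h' : F.AxWire p' q') {g : IAtom A} (hg : e p = Point.atom g) (hg' : e p' = Point.atom g) :
    p' = p ∨ p' = q := by
  have := hinj p q p' q' h h' ⟨g, by rw [hg, hg']; exact ⟨rfl, rfl⟩⟩
  rw [Sym2.eq_iff] at this
  tauto

namespace PortEquiv

variable [Fintype C] [Fintype P] [Fintype C'] [Fintype P'] {ind : F.Indexing}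
  {ind' : F'.Indexing} {φ : P ≃ P'}

theorem axWire_iff (h : PortEquiv ind ind' φ) (p q : P) :
    F'.AxWire (φ p) (φ q) ↔ F.AxWire p q := by
  rw [AxWire, AxWire, h.adj_iff, h.isPri_iff, h.isPri_iff]

theorem isRight_iff (h : PortEquiv ind ind' φ) {l : C} (hl : F.IsMult l) (q : P) :
    F'.IsRight (h.cell l) (φ q) ↔ F.IsRight l q := by
  rw [Ports.IsRight, Ports.IsRight, h.mem_aux_iff, h.left_cell hl]
  simp only [EmbeddingLike.apply_eq_iff_eq, ne_eq]

/-- Labels are computed from the axioms downwards. A renaming that commutes with `dig` passes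
through every cell, exponential ones included, so agreement on axioms suffices. -/
theorem ren_eq_of_axWire (h : PortEquiv ind ind' φ) (hF : F.IsPLPS) (hF' : F'.IsPLPS)
    (he : F.IsExperiment k e) (he' : F'.IsExperiment k e') (t : IAtom A ≃. IAtom A)
    (ht : ∀ d s, t (dig s d) = (t d).map (dig s))
    (hax : ∀ p q, F.AxWire p q → RenDom t (e p) ∧ ren t (e p) = e' (φ p)) (p : P) :
    RenDom t (e p) ∧ ren t (e p) = e' (φ p) := by
  have hdig : ∀ s (a : IPoint A), ren t (a.map (dig s)) = (ren t a).map (dig s) := by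
    intro s a
    rw [ren, ren, Point.map_map, Point.map_map]
    congr 1
    funext d
    simp only [Function.comp_apply, ht]
    cases t d <;> rfl
  induction p using hF.induction with
  | h p ih =>
    by_cases hp : F.IsPri p
    · obtain ⟨l, rfl⟩ := hp
      have ih' : ∀ q ∈ F.aux l, RenDom t (e q) ∧ ren t (e q) = e' (φ q) := fun q hq =>
        ih q (PPLPS.mem_aux_iff.mp hq).1 (PPLPS.mem_aux_iff.mp hq).2
      rw [← h.pri_cell]
      rcases F.type_cases l with hl | hl | hl
      · obtain ⟨q, hq, -⟩ := isRight_unique hl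
        have h₁ := ih' _ (left_mem_aux hl)
        have h₂ := ih' q hq.1
        rw [he.pair hl hq, he'.pair ((h.isMult_cell l).mpr hl) ((h.isRight_iff hl q).mpr hq),
          h.type_cell, h.left_cell hl, ← h₁.2, ← h₂.2]
        refine ⟨fun d hd => ?_, Point.map_pair _ _ _ _⟩
        rw [Point.atoms_pair] at hd
        exact hd.elim (h₁.1 d) (h₂.1 d)
      · rw [he.star hl, he'.star (by rwa [h.type_cell]), h.type_cell]
        exact ⟨fun d hd => absurd hd (by simp [Point.atoms_star]), rfl⟩
      · rw [he.bag hl, he'.bag (by rwa [h.type_cell]), h.type_cell]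
        constructor
        · intro d hd
          obtain ⟨x, hx, hd⟩ := Point.mem_atoms_bag.mp hd
          obtain ⟨q, hq, hx⟩ := Multiset.mem_sum.mp hx
          obtain ⟨s, rfl⟩ := mem_digBag.mp hx
          rw [Point.atoms_map] at hd
          obtain ⟨d, hd', rfl⟩ := hd
          rw [ht, Option.isSome_map]
          exact (ih' q hq).1 d hd'
        · rw [ren, Point.map_bag, h.aux_cell, Finset.sum_map]
          congr 1
          rw [← Multiset.coe_mapAddMonoidHom, map_sum]
          refine Finset.sum_congr rfl fun q hq => ?_
          change _ = digBag k (F'.weight (h.cell l) (φ q)) {e' (φ q)}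
          rw [h.weight_cell hF hF' hq, digBag, digBag, map_sum]
          refine Finset.sum_congr rfl fun s _ => ?_
          rw [Multiset.coe_mapAddMonoidHom, Multiset.map_singleton, Multiset.map_singleton,
            Multiset.map_singleton, ← (ih' q hq).2, ← hdig]
          rfl
    · rcases axWire_or_of_not_isPri hp with ⟨q, hq⟩ | ⟨l, hl⟩
      · exact hax p q hq
      · have hb := below_iff.mp (.inr ⟨⟨l, rfl⟩, isAux_of_adj hl.symm ⟨l, rfl⟩, hl⟩ :
          F.Below p (F.pri l))
        rw [he.wire _ _ hl fun hc => hc.2.2 ⟨l, rfl⟩, he'.wire _ _ ((h.adj_iff _ _).mpr hl)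
          fun hc => hc.2.2 ((h.isPri_iff _).mpr ⟨l, rfl⟩)]
        exact ih _ hb.1 hb.2

theorem exists_ren (h : PortEquiv ind ind' φ) (hF : F.IsPLPS) (hF' : F'.IsPLPS)
    (he : F.IsExperiment k e) (hat : F.IsAtomic e) (hinj : F.IsInjective e)
    (he' : F'.IsExperiment k e') (hat' : F'.IsAtomic e') (hinj' : F'.IsInjective e') :
    ∃ t : IAtom A ≃. IAtom A, ∀ p, RenDom t (e p) ∧ ren t (e p) = e' (φ p) := by
  -- The atom of an axiom goes to the atom of its image, and integer sequences are kept, which gives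
  -- compatibility with `dig`. Injectivity of the two experiments makes the relation single-valued
  -- in both directions, since an atom determines its axiom and both ends of an axiom carry the same
  -- atom.
  obtain ⟨t, ht⟩ := exists_pequiv (fun d d' : IAtom A => d.2 = d'.2 ∧ ∃ p q, F.AxWire p q ∧
      e p = Point.atom (d.1, []) ∧ e' (φ p) = Point.atom (d'.1, []))
    (by
      rintro ⟨a, s⟩ ⟨b, s'⟩ ⟨c, s''⟩ ⟨h₁, p, q, hpq, hp, hp'⟩ ⟨h₂, p₂, q₂, hpq₂, hp₂, hp₂'⟩
      obtain ⟨g, hg, hg'⟩ := he'.exists_atom hat' ((h.axWire_iff p q).mpr hpq)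
      have hb : e' (φ p₂) = e' (φ p) := by
        rcases hinj.eq_or_eq hpq hpq₂ hp hp₂ with rfl | rfl
        · rfl
        · rw [hg, hg']
      rw [hp', hp₂'] at hb
      exact Prod.ext (Prod.mk.inj (Point.atom_injective hb)).1.symm (h₁.symm.trans h₂))
    (by
      rintro ⟨a, s⟩ ⟨b, s'⟩ ⟨c, s''⟩ ⟨h₁, p, q, hpq, hp, hp'⟩ ⟨h₂, p₂, q₂, hpq₂, hp₂, hp₂'⟩
      obtain ⟨g, hg, hg'⟩ := he.exists_atom hat hpq
      have hb : e p₂ = e p := by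
        rcases hinj'.eq_or_eq ((h.axWire_iff p q).mpr hpq) ((h.axWire_iff _ _).mpr hpq₂) hp' hp₂'
          with hc | hc
        · rw [φ.injective hc]
        · rw [φ.injective hc, hg, hg']
      rw [hp, hp₂] at hb
      exact Prod.ext (Prod.mk.inj (Point.atom_injective hb)).1.symm (h₁.trans h₂.symm))
  refine ⟨t, h.ren_eq_of_axWire hF hF' he he' t (fun d s => ?_) fun p q hpq => ?_⟩
  · cases hd : t d with
    | some d' =>
      obtain ⟨h₁, h₂⟩ := (ht _ _).mp hd
      rw [Option.map_some, ht]
      exact ⟨congrArg (· ++ s) h₁, h₂⟩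
    | none =>
      rw [Option.map_none, Option.eq_none_iff_forall_ne_some]
      intro d' hd'
      obtain ⟨-, h₂⟩ := (ht _ _).mp hd'
      rw [(ht d (d'.1, d.2)).mpr ⟨rfl, h₂⟩] at hd
      cases hd
  · obtain ⟨g, hg, -⟩ := he.exists_atom hat hpq
    obtain ⟨g', hg', -⟩ := he'.exists_atom hat' ((h.axWire_iff p q).mpr hpq)
    have hgg : t (g, []) = some (g', []) := (ht _ _).mpr ⟨rfl, p, q, hpq, hg, hg'⟩
    rw [hg, hg']
    constructor
    · rintro d rfl
      rw [hgg]
      rfl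
    · rw [ren, Point.map_atom, hgg]
      rfl

theorem expIsoAt (h : PortEquiv ind ind' φ) (hF : F.IsPLPS) (hF' : F'.IsPLPS)
    (he : F.IsExperiment k e) (hat : F.IsAtomic e) (hinj : F.IsInjective e)
    (he' : F'.IsExperiment k e') (hat' : F'.IsAtomic e') (hinj' : F'.IsInjective e') :
    ExpIsoAt ind ind' e (ind.result e) e' (ind'.result e') := by
  obtain ⟨t, ht⟩ := h.exists_ren hF hF' he hat hinj he' hat' hinj'
  have hren : ∀ a : IPoint A, ren (PEquiv.refl _) a = a := by
    intro a
    refine Quotient.inductionOn a fun a => congrArg (Quotient.mk _) ?_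
    induction a with
    | atom x => rfl
    | star i => rfl
    | pair i a b ha hb => simp only [PrePoint.map, ha, hb]
    | bag i n f ih => simp only [PrePoint.map, ih]
  have hcard : Nat.card F.conclusions = Nat.card F'.conclusions :=
    Nat.card_congr (φ.subtypeEquiv fun p => (h.conclusions_iff p).symm)
  -- `t` already carries the labels of `e` to those of `e'`, so the second renaming can be the
  -- identity.
  refine ⟨h.indIso hF hF', t, PEquiv.refl _, fun p => (ht p).1, fun _ _ _ => rfl,
    fun p => (ht p).2.trans (hren _).symm, fun a ha => ?_, fun _ _ _ _ => rfl, ?_⟩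
  · obtain ⟨i, rfl⟩ := (List.mem_ofFn' _ _).mp ha
    exact (ht _).1
  · refine List.ext_getElem ?_ fun i h₁ h₂ => ?_
    · simpa only [Indexing.result, List.length_map, List.length_ofFn] using hcard
    · simp only [List.length_map, Indexing.result, List.length_ofFn] at h₁ h₂
      simp only [Indexing.result, List.getElem_map, List.getElem_ofFn, hren, (ht _).2]
      obtain ⟨hc, hi⟩ := (h.indIso hF hF').ind_eq (ind.symm ⟨i, h₁⟩)
      congr 1
      rw [Equiv.apply_symm_apply] at hi
      have : ind' ⟨φ (ind.symm ⟨i, h₁⟩), hc⟩ = ⟨i, h₂⟩ := Fin.ext hi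
      rw [← this, Equiv.symm_apply_apply]

end PortEquiv
end PPLPS
-- Forests determined by their labels
theorem card_fiber_eq_count {X K : Type*} [DecidableEq K] (s : Finset X) (G : X → K) (a : K) :
    Fintype.card {c : s // G c = a} = Multiset.count a (s.val.map G) := by
  rw [Multiset.count_map, Fintype.card_subtype, ← Finset.filter_val, ← Finset.card_def,
    ← Finset.card_map (Function.Embedding.subtype _)]
  congr 1
  ext z
  simp only [Finset.mem_map, Finset.mem_filter, Finset.mem_univ, true_and,
    Function.Embedding.subtype_apply, Subtype.exists, exists_and_right, exists_eq_right]
  exact ⟨fun ⟨h, h'⟩ => ⟨h, h'.symm⟩, fun ⟨h, h'⟩ => ⟨h, h'.symm⟩⟩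

theorem exists_equiv_of_map_val_eq {X Y K : Type*} (s : Finset X) (s' : Finset Y) (G : X → K)
    (G' : Y → K) (h : s.val.map G = s'.val.map G') :
    ∃ β : s ≃ s', ∀ c, G' (β c) = G c := by
  classical
  have hc : ∀ a, Fintype.card {c : s // G c = a} = Fintype.card {c : s' // G' c = a} := by
    intro a
    rw [card_fiber_eq_count s G a, card_fiber_eq_count s' G' a, h]
  exact ⟨Equiv.ofFiberEquiv (f := fun c : s => G c) (g := fun c : s' => G' c)
    fun a => Fintype.equivOfCardEq (hc a), fun c =>
      Equiv.ofFiberEquiv_map (f := fun c : s => G c) (g := fun c : s' => G' c) _ c⟩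

/-- Two finite forests are isomorphic when their roots correspond to each other and the labels of
the children of a node are determined by the label of the node. -/
theorem exists_equiv_of_map_children_eq {X Y K : Type*} (par : X → X) (par' : Y → Y)
    (ch : X → Finset X) (ch' : Y → Finset Y)
    (hch : ∀ x c, c ∈ ch x ↔ par c = x ∧ c ≠ x) (hch' : ∀ x c, c ∈ ch' x ↔ par' c = x ∧ c ≠ x)
    (hht : ∃ h : X → ℕ, ∀ x, par x ≠ x → h (par x) < h x)
    (hht' : ∃ h : Y → ℕ, ∀ x, par' x ≠ x → h (par' x) < h x)
    (G : X → K) (G' : Y → K) (β₀ : {x // par x = x} ≃ {y // par' y = y})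
    (hβ₀ : ∀ x, G' (β₀ x) = G x)
    (hloc : ∀ x y, G' y = G x → (ch x).val.map G = (ch' y).val.map G') :
    ∃ ψ : X ≃ Y, (∀ x, ψ (par x) = par' (ψ x)) ∧ ∀ x, G' (ψ x) = G x := by
  classical
  obtain ⟨h, hh⟩ := hht
  obtain ⟨h', hh'⟩ := hht'
  choose β hβ using fun (x : X) (y : Y) (e : G' y = G x) =>
    exists_equiv_of_map_val_eq (ch x) (ch' y) G G' (hloc x y e)
  have hmem : ∀ x, par x ≠ x → x ∈ ch (par x) := fun x hx => (hch _ _).mpr ⟨rfl, hx.symm⟩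
  have hmem' : ∀ y, par' y ≠ y → y ∈ ch' (par' y) := fun y hy => (hch' _ _).mpr ⟨rfl, hy.symm⟩
  -- Recursion from the roots: the image of `x` is chosen among the children of the image of its
  -- parent. The accompanying equality of labels is what makes the bijection `β` of children
  -- available.
  let step (x : X) (rec : ∀ z, h z < h x → {y : Y // G' y = G z}) : {y : Y // G' y = G x} :=
    if hx : par x = x then ⟨β₀ ⟨x, hx⟩, hβ₀ ⟨x, hx⟩⟩
    else ⟨β (par x) (rec (par x) (hh x hx)).1 (rec (par x) (hh x hx)).2 ⟨x, hmem x hx⟩,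
      hβ _ _ _ _⟩
  let g (x : X) : {y : Y // G' y = G x} := (InvImage.wf h Nat.lt_wfRel.wf).fix step x
  have hg : ∀ x, g x = step x fun z _ => g z := fun x =>
    (InvImage.wf h Nat.lt_wfRel.wf).fix_eq step x
  have hroot : ∀ x (hx : par x = x), (g x).1 = β₀ ⟨x, hx⟩ := by
    intro x hx
    rw [hg]
    simp only [step, dif_pos hx]
  have hchild : ∀ x (hx : par x ≠ x),
      (g x).1 = β (par x) (g (par x)).1 (g (par x)).2 ⟨x, hmem x hx⟩ := by
    intro x hx
    rw [hg]
    simp only [step, dif_neg hx]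
  have hchild' : ∀ x, par x ≠ x → par' (g x).1 = (g (par x)).1 ∧ (g x).1 ≠ (g (par x)).1 := by
    intro x hx
    rw [hchild x hx, ← hch']
    exact Subtype.property _
  have hpar : ∀ x, par' (g x).1 = (g (par x)).1 := by
    intro x
    by_cases hx : par x = x
    · rw [hx, hroot x hx]
      exact (β₀ ⟨x, hx⟩).2
    · exact (hchild' x hx).1
  have hroot_iff : ∀ x, par' (g x).1 = (g x).1 ↔ par x = x := by
    intro x
    refine ⟨fun hy => ?_, fun hx => ?_⟩
    · by_contra hx
      exact (hchild' x hx).2 (hy.symm.trans (hchild' x hx).1)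
    · rw [hpar, hx]
  have hinj : ∀ n x x', h x = n → (g x).1 = (g x').1 → x = x' := by
    intro n
    induction n using Nat.strong_induction_on with
    | _ n ih =>
      rintro x x' rfl hxx
      by_cases hx : par x = x
      · have hx' : par x' = x' := by rw [← hroot_iff, ← hxx, hroot_iff, hx]
        rw [hroot x hx, hroot x' hx'] at hxx
        exact congrArg Subtype.val (β₀.injective (Subtype.ext hxx))
      · have hx' : par x' ≠ x' := by rwa [ne_eq, ← hroot_iff, ← hxx, hroot_iff]
        have hp : par x = par x' := by
          refine ih _ (hh x hx) _ _ rfl ?_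
          rw [← hpar, ← hpar, hxx]
        rw [hchild x hx, hchild x' hx'] at hxx
        -- The parents are generalised to variables so that their equality can be substituted in the
        -- dependent arguments of `β`.
        have key : ∀ z z' (hz : x ∈ ch z) (hz' : x' ∈ ch z'), z = z' →
            (β z (g z).1 (g z).2 ⟨x, hz⟩ : Y) = β z' (g z').1 (g z').2 ⟨x', hz'⟩ → x = x' := by
          rintro z _ hz hz' rfl he
          exact congrArg Subtype.val ((β z _ _).injective (Subtype.ext he))
        exact key _ _ _ _ hp hxx
  have hsurj : ∀ n y, h' y = n → ∃ x, (g x).1 = y := by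
    intro n
    induction n using Nat.strong_induction_on with
    | _ n ih =>
      rintro y rfl
      by_cases hy : par' y = y
      · refine ⟨β₀.symm ⟨y, hy⟩, ?_⟩
        rw [hroot _ (β₀.symm ⟨y, hy⟩).2, Subtype.coe_eta, Equiv.apply_symm_apply]
      · obtain ⟨z, hz⟩ := ih _ (hh' y hy) (par' y) rfl
        have hy' : y ∈ ch' (g z).1 := by rw [hz]; exact hmem' y hy
        let c := (β z (g z).1 (g z).2).symm ⟨y, hy'⟩
        obtain ⟨hc₁, hc₂⟩ := (hch _ _).mp c.2
        refine ⟨c, ?_⟩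
        have key : ∀ w (hw : c.1 ∈ ch w), w = z →
            (β w (g w).1 (g w).2 ⟨c, hw⟩ : Y) = y := by
          rintro _ hw rfl
          simp [c]
        rw [hchild c (by rw [hc₁]; exact hc₂.symm)]
        exact key _ _ hc₁
  exact ⟨Equiv.ofBijective (fun x => (g x).1) ⟨fun x x' e => hinj _ x x' rfl e,
    fun y => hsurj _ y rfl⟩, fun x => (hpar x).symm, fun x => (g x).2⟩

/-! ### Labels of the nodes of the expansion -/

/-- The cell type that a representative of a point shows, if it is not an atom. -/
def PrePoint.kind {X : Type u} : PrePoint X → Option CellType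
  | .atom _ => none
  | .star .pos => some .one
  | .star .neg => some .bot
  | .pair .pos _ _ => some .tens
  | .pair .neg _ _ => some .parr
  | .bag .pos _ _ => some .bang
  | .bag .neg _ _ => some .quest

/-- The cell type that a point shows, if it is not an atom. -/
def Point.kind {X : Type u} : Point X → Option CellType :=
  Quotient.lift PrePoint.kind fun _ _ h => by
    have h : PrePoint.Rel _ _ := h
    cases h with
    | atom => rfl
    | star => rfl
    | pair i => cases i <;> rfl
    | bag i => cases i <;> rfl

theorem Point.kind_map {X : Type u} {Y : Type v} (f : X → Y) (a : Point X) :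
    (map f a).kind = a.kind := by
  refine Quotient.inductionOn a fun a => ?_
  rcases a with x | i | ⟨i, _, _⟩ | ⟨i, _, _⟩
  · rfl
  all_goals cases i <;> rfl

theorem Point.kind_pair {X : Type u} (i : Polarity) (a b : Point X) :
    (pair i a b).kind = (pair i (star .pos) (star .pos) : Point X).kind := by
  refine Quotient.inductionOn₂ a b fun a b => ?_
  cases i <;> rfl

namespace BoxForest.Node

variable {V L : Type*} {S : BoxForest V L} {k D : ℕ} [Finite V]

/-- The children of a node. -/
noncomputable def children (x : S.Node k D) : Finset (S.Node k D) :=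
  (Set.toFinite {c | c.par = x ∧ c ≠ x}).toFinset

theorem mem_children {x c : S.Node k D} : c ∈ x.children ↔ c.par = x ∧ c ≠ x := by
  simp [children]

end BoxForest.Node

namespace PPLPS

open BoxForest

variable {A C P : Type*} {F : PPLPS C P} {k : ℕ} {e : P → IPoint A}

theorem IsExperiment.kind_pri (he : F.IsExperiment k e) (l : C) :
    (e (F.pri l)).kind = some (F.type l) := by
  rcases F.type_cases l with h | h | h
  · obtain ⟨q, hq, -⟩ := isRight_unique h
    rw [he.pair h hq, Point.kind_pair]
    rcases h with h | h <;> rw [h] <;> rfl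
  · rw [he.star h]
    rcases h with h | h <;> rw [h] <;> rfl
  · rw [he.bag h]
    rcases h with h | h <;> rw [h] <;> rfl

/-- The sequence of integers given by the indices of a node. -/
def code (t : List (Fin k)) : List ℕ := (t.map fun i : Fin k => (i : ℕ) + 1).reverse

theorem code_append (s t : List (Fin k)) : code (s ++ t) = code t ++ code s := by
  simp [code]

theorem code_injective : Function.Injective (code : List (Fin k) → List ℕ) := by
  intro s t h
  exact List.map_injective_iff.mpr (fun i j h => Fin.ext (Nat.succ_injective h))
    (List.reverse_injective h)

/-- `dig` appends the indices of outer boxes last, whereas nodes list them first. A block of indices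
from `digBag` therefore enters a node in reversed order. -/
theorem code_reverse_ofFn {n : ℕ} (s : Fin n → Fin k) :
    code (List.ofFn s).reverse = List.ofFn fun i => (s i : ℕ) + 1 := by
  rw [code, List.map_reverse, List.reverse_reverse, List.map_ofFn]
  rfl

theorem map_dig_dig (s t : List ℕ) (a : IPoint A) :
    (a.map (dig t)).map (dig s) = a.map (dig (t ++ s)) := by
  rw [Point.map_map]
  congr 1
  funext d
  simp [dig]

section

variable [Fintype C] [Fintype P] {ind : F.Indexing} {hF : F.IsLPS}

/-- The copy of the label of a port that belongs to a node. -/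
def nodeLabel (e : P → IPoint A) (x : (ind.forest hF).Node k 0) : IPoint A :=
  (e x.1.1).map (dig (code x.1.2))

theorem mem_children_pri {l : C} {x c : (ind.forest hF).Node k 0} (hx : x.1.1 = F.pri l) :
    c ∈ x.children ↔ c.1.1 ∈ F.aux l ∧ ∃ u, c.1.2 = x.1.2 ++ u := by
  have hxl : x.1.2.length = F.depth x.1.1 := x.2
  rw [Node.mem_children]
  constructor
  · rintro ⟨hc, hne⟩
    have hp : F.par c.1.1 = F.pri l := by
      rw [← hx, ← hc]; rfl
    have hne' : c.1.1 ≠ F.pri l := by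
      intro h
      apply hne
      rw [← hc, Node.par_eq]
      exact hp.trans h.symm
    refine ⟨mem_aux_iff.mpr ⟨hp, hne'⟩, c.1.2.drop (F.depth (F.par c.1.1)), ?_⟩
    rw [← hc]
    exact (List.take_append_drop _ _).symm
  · rintro ⟨hc, u, hu⟩
    obtain ⟨hp, hne⟩ := mem_aux_iff.mp hc
    refine ⟨Node.ext' (hp.trans hx.symm) ?_, fun h => hne (by rw [h, hx])⟩
    change c.1.2.take (F.depth (F.par c.1.1)) = x.1.2
    rw [hp, ← hx, ← hxl, hu, List.take_left]

theorem length_of_mem_children_pri {l : C} {x c : (ind.forest hF).Node k 0} (hx : x.1.1 = F.pri l)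
    (hc : c.1.1 ∈ F.aux l) {u : List (Fin k)} (hu : c.1.2 = x.1.2 ++ u) :
    u.length = F.weight l c.1.1 := by
  have h₁ : x.1.2.length = F.depth x.1.1 := x.2
  have h₂ : c.1.2.length = F.depth c.1.1 := c.2
  have h₃ := depth_of_mem_aux hF.isPLPS hc
  rw [hu, List.length_append] at h₂
  rw [hx] at h₁
  omega

/-- The child of a node at a given auxiliary port with given additional indices. -/
def child (x : (ind.forest hF).Node k 0) {l : C} (hx : x.1.1 = F.pri l) {q : P} (hq : q ∈ F.aux l)
    {u : List (Fin k)} (hu : u.length = F.weight l q) : (ind.forest hF).Node k 0 :=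
  ⟨(q, x.1.2 ++ u), by
    have h₁ : x.1.2.length = F.depth x.1.1 := x.2
    change _ = F.depth q - 0
    rw [List.length_append, h₁, hx, depth_of_mem_aux hF.isPLPS hq, hu, Nat.sub_zero]⟩

theorem child_mem (x : (ind.forest hF).Node k 0) {l : C} (hx : x.1.1 = F.pri l) {q : P}
    (hq : q ∈ F.aux l) {u : List (Fin k)} (hu : u.length = F.weight l q) :
    child x hx hq hu ∈ x.children :=
  (mem_children_pri hx).mpr ⟨hq, u, rfl⟩

/-- The copies made by `digBag` are the children in the expansion: an auxiliary port of weight `n`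
has `n` more indices than its principal port, and the `k ^ n` extensions of the index sequence match
the `k ^ n` appended sequences. -/
theorem nodeLabel_bag (he : F.IsExperiment k e) {l : C} {x : (ind.forest hF).Node k 0}
    (hx : x.1.1 = F.pri l) (hl : F.type l = .bang ∨ F.type l = .quest) :
    nodeLabel e x = .bag (F.type l).polarity (x.children.val.map (nodeLabel e)) := by
  rw [nodeLabel, hx, he.bag hl, Point.map_bag]
  congr 1
  have h₁ : x.children.val.map (nodeLabel e) = ∑ c ∈ x.children, {nodeLabel e c} := by
    have := Multiset.sum_map_singleton (x.children.val.map (nodeLabel e))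
    rw [Multiset.map_map] at this
    exact this.symm
  have h₂ : ∀ (n : ℕ) (a : IPoint A), (digBag k n {a}).map (Point.map (dig (code x.1.2))) =
      ∑ s : Fin n → Fin k, {a.map (dig (code (x.1.2 ++ (List.ofFn s).reverse)))} := by
    intro n a
    rw [digBag, ← Multiset.coe_mapAddMonoidHom, map_sum]
    refine Finset.sum_congr rfl fun s _ => ?_
    rw [Multiset.coe_mapAddMonoidHom, Multiset.map_singleton, Multiset.map_singleton, map_dig_dig,
      code_append, code_reverse_ofFn]
  rw [h₁, ← Multiset.coe_mapAddMonoidHom, map_sum]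
  simp only [Multiset.coe_mapAddMonoidHom, h₂]
  rw [Finset.sum_sigma']
  refine Finset.sum_bij (fun p hp => child x hx (Finset.mem_sigma.mp hp).1
    (u := (List.ofFn p.2).reverse) (by simp)) (fun p hp => child_mem _ _ _ _) ?_ ?_
    fun p hp => rfl
  · rintro ⟨q, s⟩ hp ⟨q', s'⟩ hp' h
    obtain ⟨h₁, h₂⟩ := Prod.mk.inj (congrArg Subtype.val h)
    obtain rfl : q = q' := h₁
    have h₂ := List.ofFn_injective (List.reverse_injective (List.append_cancel_left h₂))
    rw [show s = s' from h₂]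
  · intro c hc
    obtain ⟨hc, u, hu⟩ := (mem_children_pri hx).mp hc
    have hlen := length_of_mem_children_pri hx hc hu
    have key : ∀ {n : ℕ} (v : List (Fin k)), v.length = n → ∃ s : Fin n → Fin k,
        List.ofFn s = v := by
      rintro _ v rfl
      exact ⟨v.get, List.ofFn_get v⟩
    obtain ⟨s, hs⟩ := key u.reverse (by rw [List.length_reverse, hlen])
    refine ⟨⟨c.1.1, s⟩, Finset.mem_sigma.mpr ⟨hc, Finset.mem_univ _⟩, Node.ext' rfl ?_⟩
    change x.1.2 ++ (List.ofFn s).reverse = c.1.2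
    rw [hs, hu, List.reverse_reverse]

/-- Multiplicative cells have weight `0`: each auxiliary port contributes one child, with the same
indices. -/
theorem nodeLabel_pair (he : F.IsExperiment k e) {l : C} {x : (ind.forest hF).Node k 0}
    (hx : x.1.1 = F.pri l) (hl : F.IsMult l) :
    ∃ c d : (ind.forest hF).Node k 0, x.children.val = {c, d} ∧ c.1.1 = F.left l ∧
      F.IsRight l d.1.1 ∧
      nodeLabel e x = .pair (F.type l).polarity (nodeLabel e c) (nodeLabel e d) := by
  classical
  have hw : ∀ q, F.weight l q = 0 := by
    intro q
    rw [weight]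
    rcases hl with h | h <;> rw [h]
  obtain ⟨q, hq, hqu⟩ := isRight_unique hl
  let c := child x hx (left_mem_aux hl) (u := []) (hw _).symm
  let d := child x hx hq.1 (u := []) (hw _).symm
  have hcd : c ≠ d := fun h => hq.2 (congrArg (fun y => y.1.1) h).symm
  have hch : x.children = {c, d} := by
    ext y
    rw [Finset.mem_insert, Finset.mem_singleton]
    refine ⟨fun hy => ?_, by rintro (rfl | rfl) <;> exact child_mem _ _ _ _⟩
    obtain ⟨hy, u, hu⟩ := (mem_children_pri hx).mp hy
    have hlen := length_of_mem_children_pri hx hy hu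
    rw [hw, List.length_eq_zero_iff] at hlen
    subst hlen
    by_cases h : y.1.1 = F.left l
    · exact .inl (Node.ext' h hu)
    · exact .inr (Node.ext' (hqu _ ⟨hy, h⟩) hu)
  refine ⟨c, d, ?_, rfl, hq, ?_⟩
  · rw [hch, Finset.insert_val_of_notMem (by simpa using hcd)]
    rfl
  · rw [nodeLabel, hx, he.pair hl hq, Point.map_pair]
    simp [nodeLabel, c, d, child]

theorem children_eq_empty {l : C} {x : (ind.forest hF).Node k 0} (hx : x.1.1 = F.pri l)
    (hl : F.type l = .one ∨ F.type l = .bot) : x.children = ∅ := by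
  rw [Finset.eq_empty_iff_forall_notMem]
  intro c hc
  have := ((mem_children_pri hx).mp hc).1
  rw [aux_eq_empty hl] at this
  exact absurd this (Finset.notMem_empty _)

theorem exists_below_of_mem_children {x c : (ind.forest hF).Node k 0} (hc : c ∈ x.children) :
    F.Below x.1.1 c.1.1 := by
  obtain ⟨hc, hne⟩ := Node.mem_children.mp hc
  have hp : F.par c.1.1 = x.1.1 := by rw [← hc]; rfl
  rw [below_iff]
  refine ⟨hp, fun h => hne ?_⟩
  rw [← hc, Node.par_eq]
  exact hp.trans h.symm

theorem children_eq_empty_of_axWire {x : (ind.forest hF).Node k 0} {q : P}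
    (hx : F.AxWire x.1.1 q) : x.children = ∅ := by
  rw [Finset.eq_empty_iff_forall_notMem]
  intro c hc
  rcases exists_below_of_mem_children hc with ⟨l, hl, -⟩ | ⟨hc, -, h⟩
  · exact hx.2.1 ⟨l, hl⟩
  · rw [F.wires_unique _ _ _ h hx.1] at hc
    exact hx.2.2 hc

/-- Depth does not change along the wire, so the only child has the same indices as `x`. -/
theorem children_of_adj (he : F.IsExperiment k e) {x : (ind.forest hF).Node k 0} {l : C}
    (hx : F.wires.Adj x.1.1 (F.pri l)) :
    ∃ c : (ind.forest hF).Node k 0, x.children.val = {c} ∧ c.1.1 = F.pri l ∧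
      nodeLabel e c = nodeLabel e x := by
  have hd := depth_of_adj hF.isPLPS hx.symm ⟨l, rfl⟩
  have hxl : x.1.2.length = F.depth x.1.1 := x.2
  let c : (ind.forest hF).Node k 0 := ⟨(F.pri l, x.1.2), by
    change _ = F.depth (F.pri l) - 0
    rw [hd, Nat.sub_zero]; exact hxl⟩
  have hb : F.Below x.1.1 (F.pri l) := .inr ⟨⟨l, rfl⟩, isAux_of_adj hx.symm ⟨l, rfl⟩, hx⟩
  have hch : x.children = {c} := by
    ext y
    rw [Finset.mem_singleton]
    constructor
    · intro hy
      have hby := exists_below_of_mem_children hy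
      have hy₁ : y.1.1 = F.pri l := by
        rcases hby with ⟨l', hl', -⟩ | ⟨-, -, h⟩
        · exact absurd ⟨l', hl'⟩ fun h => not_isPri_of_mem_aux
            (isAux_of_adj hx.symm ⟨l, rfl⟩).choose_spec h
        · exact F.wires_unique _ _ _ h hx
      refine Node.ext' hy₁ ?_
      have hy₂ : y.1.2.take (F.depth (F.par y.1.1)) = x.1.2 := by
        rw [← (Node.mem_children.mp hy).1]; rfl
      have hy₃ : y.1.2.length = F.depth y.1.1 := y.2
      rw [hby.par_eq, ← hd, ← hy₁, ← hy₃, List.take_length] at hy₂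
      exact hy₂
    · rintro rfl
      refine Node.mem_children.mpr ⟨Node.ext' hb.par_eq ?_, fun h => hb.ne ?_⟩
      · change x.1.2.take (F.depth (F.par (F.pri l))) = x.1.2
        rw [hb.par_eq, ← hxl, List.take_length]
      · exact (congrArg (fun y => y.1.1) h).symm
  refine ⟨c, by rw [hch]; rfl, rfl, ?_⟩
  rw [nodeLabel, nodeLabel, he.wire _ _ hx fun h => h.2.2 ⟨l, rfl⟩]

/-- The atoms of the label of a node occur in the label of its parent. -/
theorem atoms_nodeLabel_subset (he : F.IsExperiment k e) {x c : (ind.forest hF).Node k 0}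
    (hc : c ∈ x.children) : (nodeLabel e c).atoms ⊆ (nodeLabel e x).atoms := by
  intro g hg
  by_cases hx : F.IsPri x.1.1
  · obtain ⟨l, hl⟩ := hx
    rcases F.type_cases l with h | h | h
    · obtain ⟨c₁, c₂, hch, -, -, hn⟩ := nodeLabel_pair he hl h
      rw [hn, Point.atoms_pair]
      have hc : c ∈ x.children.val := hc
      rw [hch, Multiset.insert_eq_cons, Multiset.mem_cons, Multiset.mem_singleton] at hc
      rcases hc with rfl | rfl
      · exact .inl hg
      · exact .inr hg
    · rw [children_eq_empty hl h] at hc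
      exact absurd hc (Finset.notMem_empty _)
    · rw [nodeLabel_bag he hl h, Point.mem_atoms_bag]
      exact ⟨_, Multiset.mem_map_of_mem _ hc, hg⟩
  · rcases axWire_or_of_not_isPri hx with ⟨q, hq⟩ | ⟨l, hl⟩
    · rw [children_eq_empty_of_axWire hq] at hc
      exact absurd hc (Finset.notMem_empty _)
    · obtain ⟨c₁, hch, -, hn⟩ := children_of_adj he hl
      have hc : c ∈ x.children.val := hc
      rw [hch, Multiset.mem_singleton] at hc
      rwa [← hn, ← hc]

end

end PPLPS
-- Reading the expansion off the result
namespace PPLPS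

open BoxForest

variable {A C P C' P' : Type*} {F : PPLPS C P} {F' : PPLPS C' P'} {k : ℕ} {e : P → IPoint A}
  {e' : P' → IPoint A} [Fintype C] [Fintype P] [Fintype C'] [Fintype P'] {ind : F.Indexing}
  {ind' : F'.Indexing} {hF : F.IsLPS} {hF' : F'.IsLPS} {f f' : IAtom A → IAtom A}

/-- The renamed label of a node together with the label of its port. -/
noncomputable def nodeKey (f : IAtom A → IAtom A) (e : P → IPoint A)
    (x : (ind.forest hF).Node k 0) : IPoint A × PortLabel :=
  ((nodeLabel e x).map f, (ind.forest hF).lab x.1.1)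

open scoped Classical in
theorem nodeKey_of_mem_aux {x : (ind.forest hF).Node k 0} {l : C} (h : x.1.1 ∈ F.aux l) :
    nodeKey f e x = ((nodeLabel e x).map f,
      none, none, some (F.type l, decide (F.IsMult l ∧ x.1.1 = F.left l))) := by
  refine Prod.ext rfl (Prod.ext ?_ (Prod.ext ?_ ?_))
  · refine (ind.index_eq_none).mpr fun hc => ?_
    rw [← par_eq_self_iff, (mem_aux_iff.mp h).1] at hc
    exact (mem_aux_iff.mp h).2 hc.symm
  · exact priType_eq_none.mpr (not_isPri_of_mem_aux h)
  · exact auxType_of_mem h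

/-- The left flag in the key lets the unordered multiset of children retain the order of the two
components. -/
theorem map_children_of_isMult (he : F.IsExperiment k e) {l : C}
    {x : (ind.forest hF).Node k 0} (hx : x.1.1 = F.pri l) (hl : F.IsMult l) :
    ∃ a b, (nodeLabel e x).map f = .pair (F.type l).polarity a b ∧
      x.children.val.map (nodeKey f e) = {(a, none, none, some (F.type l, true)),
        (b, none, none, some (F.type l, false))} := by
  classical
  obtain ⟨c, d, hch, hc, hd, hn⟩ := nodeLabel_pair he hx hl
  refine ⟨_, _, by rw [hn, Point.map_pair], ?_⟩
  have hc' : c.1.1 ∈ F.aux l := by rw [hc]; exact left_mem_aux hl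
  have h₁ := nodeKey_of_mem_aux (f := f) (e := e) hc'
  have h₂ := nodeKey_of_mem_aux (f := f) (e := e) hd.1
  rw [decide_eq_true ⟨hl, hc⟩] at h₁
  rw [decide_eq_false fun h => hd.2 h.2] at h₂
  rw [hch, Multiset.insert_eq_cons, Multiset.map_cons, Multiset.map_singleton, h₁, h₂]
  rfl

theorem map_children_of_bag (he : F.IsExperiment k e) {l : C} {x : (ind.forest hF).Node k 0}
    (hx : x.1.1 = F.pri l) (hl : F.type l = .bang ∨ F.type l = .quest) :
    ∃ m, (nodeLabel e x).map f = .bag (F.type l).polarity m ∧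
      x.children.val.map (nodeKey f e) =
        m.map fun a => (a, none, none, some (F.type l, false)) := by
  classical
  refine ⟨_, by rw [nodeLabel_bag he hx hl, Point.map_bag], ?_⟩
  rw [Multiset.map_map, Multiset.map_map]
  refine Multiset.map_congr rfl fun c hc => ?_
  have hm : ¬ F.IsMult l := by
    rintro (h | h) <;> rw [h] at hl <;> simp at hl
  rw [nodeKey_of_mem_aux ((mem_children_pri hx).mp hc).1, decide_eq_false fun h => hm h.1]
  rfl

theorem kind_nodeKey_of_axWire (he : F.IsExperiment k e) (hat : F.IsAtomic e)
    {x : (ind.forest hF).Node k 0} {q : P} (h : F.AxWire x.1.1 q) :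
    (nodeKey f e x).1.kind = none := by
  obtain ⟨g, hg, -⟩ := he.exists_atom hat h
  rw [nodeKey, nodeLabel, hg]
  rfl

theorem kind_nodeKey_of_adj (he : F.IsExperiment k e) {l : C} {x : (ind.forest hF).Node k 0}
    (h : F.wires.Adj x.1.1 (F.pri l)) : (nodeKey f e x).1.kind = some (F.type l) := by
  rw [nodeKey, nodeLabel, he.wire _ _ h fun h => h.2.2 ⟨l, rfl⟩, Point.kind_map, Point.kind_map,
    he.kind_pri]

theorem map_children_of_adj (he : F.IsExperiment k e) {l : C}
    {x : (ind.forest hF).Node k 0} (hx : F.wires.Adj x.1.1 (F.pri l)) :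
    x.children.val.map (nodeKey f e) =
      {((nodeKey f e x).1, none, some (F.type l), none)} := by
  obtain ⟨c, hch, hc, hn⟩ := children_of_adj he hx
  rw [hch, Multiset.map_singleton]
  congr 1
  refine Prod.ext ?_ (Prod.ext ?_ (Prod.ext ?_ ?_))
  · change (nodeLabel e c).map f = _
    rw [hn]
    rfl
  · refine (ind.index_eq_none).mpr fun hm => hm ⟨⟨l, ?_⟩, x.1.1, ?_⟩
    · rw [hc]; exact F.pri_mem l
    · rw [hc]; exact hx.symm
  · change F.priType c.1.1 = _
    rw [hc, priType_pri]
  · refine auxType_eq_none.mpr fun ⟨l', hl'⟩ => not_isPri_of_mem_aux hl' ⟨l, hc⟩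

/-- The keys of the children of a node are determined by the key of the node. -/
theorem map_children_eq (he : F.IsExperiment k e) (hat : F.IsAtomic e)
    (he' : F'.IsExperiment k e') (hat' : F'.IsAtomic e') (x : (ind.forest hF).Node k 0)
    (y : (ind'.forest hF').Node k 0) (h : nodeKey f' e' y = nodeKey f e x) :
    x.children.val.map (nodeKey f e) = y.children.val.map (nodeKey f' e') := by
  have hpt : (nodeLabel e' y).map f' = (nodeLabel e x).map f := congrArg Prod.fst h
  have hpri : F'.priType y.1.1 = F.priType x.1.1 := congrArg (fun q => q.2.2.1) h
  by_cases hx : F.IsPri x.1.1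
  · obtain ⟨l, hl⟩ := hx
    have hy : F'.IsPri y.1.1 := by
      by_contra hc
      rw [priType_eq_none.mpr hc, hl, priType_pri] at hpri
      cases hpri
    obtain ⟨l', hl'⟩ := hy
    have ht : F'.type l' = F.type l := by
      rw [hl, hl', priType_pri, priType_pri] at hpri
      exact Option.some.inj hpri
    rcases F.type_cases l with hc | hc | hc
    · obtain ⟨a, b, h₁, h₂⟩ := map_children_of_isMult (f := f) he hl hc
      obtain ⟨a', b', h₁', h₂'⟩ := map_children_of_isMult (f := f') he' hl'
        (by rwa [Cells.IsMult, ht])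
      rw [h₁, h₁'] at hpt
      obtain ⟨-, rfl, rfl⟩ := Point.pair_inj hpt
      rw [h₂, h₂', ht]
    · rw [children_eq_empty hl hc, children_eq_empty hl' (by rwa [ht])]
      rfl
    · obtain ⟨m, h₁, h₂⟩ := map_children_of_bag (f := f) he hl hc
      obtain ⟨m', h₁', h₂'⟩ := map_children_of_bag (f := f') he' hl' (by rwa [ht])
      rw [h₁, h₁'] at hpt
      obtain ⟨-, rfl⟩ := Point.bag_inj hpt
      rw [h₂, h₂', ht]
  · have hy : ¬ F'.IsPri y.1.1 := by rwa [← priType_eq_none, hpri, priType_eq_none]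
    -- The label tells an axiom port, labelled by an atom, from a port wired to a cell, whose type
    -- it shows; the mixed cases are impossible.
    rcases axWire_or_of_not_isPri hx with ⟨q, hq⟩ | ⟨l, hl⟩ <;>
      rcases axWire_or_of_not_isPri hy with ⟨q', hq'⟩ | ⟨l', hl'⟩
    · rw [children_eq_empty_of_axWire hq, children_eq_empty_of_axWire hq']
      rfl
    · have := kind_nodeKey_of_axWire (f := f) he hat hq
      rw [← h, kind_nodeKey_of_adj he' hl'] at this
      cases this
    · have := kind_nodeKey_of_adj (f := f) he hl
      rw [← h, kind_nodeKey_of_axWire he' hat' hq'] at this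
      cases this
    · have := kind_nodeKey_of_adj (f := f) he hl
      rw [← h, kind_nodeKey_of_adj he' hl', Option.some.injEq] at this
      rw [map_children_of_adj he hl, map_children_of_adj he' hl', h, this]

theorem nodePar_eq_iff {x : (ind.forest hF).Node k 0} : x.par = x ↔ x.1.1 ∈ F.conclusions := by
  rw [← par_eq_self_iff]
  exact ⟨Node.par_fst_eq, fun h => Node.par_eq (S := ind.forest hF) h⟩

theorem depth_of_mem_conclusions {p : P} (hp : p ∈ F.conclusions) : F.depth p = 0 :=
  depth_of_par_eq_self (par_eq_self_iff.mpr hp)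

theorem snd_eq_nil {x : (ind.forest hF).Node k 0} (hx : x.1.1 ∈ F.conclusions) : x.1.2 = [] := by
  have h : x.1.2.length = F.depth x.1.1 := x.2
  rwa [depth_of_mem_conclusions hx, List.length_eq_zero_iff] at h

/-- The roots of the expansion are the conclusions. -/
noncomputable def rootEquiv (ind : F.Indexing) (hF : F.IsLPS) (k : ℕ) :
    {x : (ind.forest hF).Node k 0 // x.par = x} ≃ F.conclusions where
  toFun x := ⟨x.1.1.1, nodePar_eq_iff.mp x.2⟩
  invFun p := ⟨⟨(p, []), (Nat.sub_eq_zero_of_le (depth_of_mem_conclusions p.2).le).symm⟩,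
    nodePar_eq_iff.mpr p.2⟩
  left_inv x := Subtype.ext (Node.ext' rfl (snd_eq_nil (nodePar_eq_iff.mp x.2)).symm)
  right_inv _ := rfl

theorem nodeLabel_root {x : (ind.forest hF).Node k 0} (hx : x.1.1 ∈ F.conclusions) :
    nodeLabel e x = e x.1.1 := by
  rw [nodeLabel, snd_eq_nil hx]
  refine Quotient.inductionOn (e x.1.1) fun a => congrArg (Quotient.mk _) ?_
  induction a with
  | atom x => simp [PrePoint.map, dig, code]
  | star i => rfl
  | pair i a b ha hb => simp only [PrePoint.map, ha, hb]
  | bag i n f ih => simp only [PrePoint.map, ih]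

/-- The key of a root depends only on its index and its label. A conclusion that is not principal is
on an axiom, so its label is an atom and shows no cell type. -/
theorem nodeKey_root (he : F.IsExperiment k e) (hat : F.IsAtomic e)
    {x : (ind.forest hF).Node k 0} (hx : x.1.1 ∈ F.conclusions) :
    nodeKey f e x = ((e x.1.1).map f, some (ind ⟨x.1.1, hx⟩ : ℕ), (e x.1.1).kind, none) := by
  have haux : ¬ F.IsAux x.1.1 := by
    rintro ⟨l, hl⟩
    rw [← par_eq_self_iff, (mem_aux_iff.mp hl).1] at hx
    exact (mem_aux_iff.mp hl).2 hx.symm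
  refine Prod.ext ?_ (Prod.ext (ind.index_of_mem hx) (Prod.ext ?_ (auxType_eq_none.mpr haux)))
  · rw [nodeKey, nodeLabel_root hx]
  · change F.priType x.1.1 = (e x.1.1).kind
    by_cases hp : F.IsPri x.1.1
    · obtain ⟨l, hl⟩ := hp
      rw [hl, priType_pri, he.kind_pri]
    · obtain ⟨q, hq, hadj⟩ := F.wires_of_not_cellPort x.1.1
        fun h => (isAux_or_isPri h).elim haux hp
      obtain ⟨g, hg, -⟩ := he.exists_atom hat ⟨hadj, hp, hq⟩
      rw [priType_eq_none.mpr hp, hg]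
      rfl

theorem exists_nodeHeight (ind : F.Indexing) (hF : F.IsLPS) (k : ℕ) :
    ∃ h : (ind.forest hF).Node k 0 → ℕ, ∀ x, x.par ≠ x → h x.par < h x := by
  obtain ⟨h, hh⟩ := (ind.forest hF).exists_height
  exact ⟨fun x => h x.1.1, fun x hx => hh _ fun hc => hx (Node.par_eq hc)⟩

/-- The atoms of the nodes are in the domain of a renaming that is defined on the result. -/
theorem renDom_nodeLabel (he : F.IsExperiment k e) {t : IAtom A ≃. IAtom A}
    (ht : ∀ a ∈ ind.result e, RenDom t a) (x : (ind.forest hF).Node k 0) :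
    RenDom t (nodeLabel e x) := by
  obtain ⟨h, hh⟩ := exists_nodeHeight ind hF k
  induction hn : h x using Nat.strong_induction_on generalizing x with
  | _ n ih =>
    subst hn
    by_cases hx : x.par = x
    · have hc := nodePar_eq_iff.mp hx
      rw [nodeLabel_root hc]
      refine ht _ ((List.mem_ofFn' _ _).mpr ⟨ind ⟨x.1.1, hc⟩, ?_⟩)
      exact congrArg (fun c => e c.1) (Equiv.symm_apply_apply ind ⟨x.1.1, hc⟩)
    · exact fun d hd => ih _ (hh x hx) x.par rfl d
        (atoms_nodeLabel_subset he (Node.mem_children.mpr ⟨rfl, Ne.symm hx⟩) hd)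

theorem nodeLabel_of_axWire (he : F.IsExperiment k e) (hat : F.IsAtomic e)
    {x : (ind.forest hF).Node k 0} {q : P} (h : F.AxWire x.1.1 q) :
    ∃ g : A, e x.1.1 = .atom (g, []) ∧ e q = .atom (g, []) ∧
      nodeLabel e x = .atom (g, code x.1.2) := by
  obtain ⟨g, hg, hg'⟩ := he.exists_atom hat h
  refine ⟨g, hg, hg', ?_⟩
  rw [nodeLabel, hg]
  rfl

theorem axWire_of_nodeKey_eq (he : F.IsExperiment k e) (hat : F.IsAtomic e)
    (he' : F'.IsExperiment k e') {x : (ind.forest hF).Node k 0}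
    {y : (ind'.forest hF').Node k 0} (h : nodeKey f' e' y = nodeKey f e x) {q : P}
    (hq : F.AxWire x.1.1 q) : ∃ q', F'.AxWire y.1.1 q' := by
  have hpri : F'.priType y.1.1 = F.priType x.1.1 := congrArg (fun q => q.2.2.1) h
  have hy : ¬ F'.IsPri y.1.1 := by
    rw [← priType_eq_none, hpri, priType_eq_none]
    exact hq.2.1
  refine (axWire_or_of_not_isPri hy).resolve_right fun ⟨l, hl⟩ => ?_
  have := kind_nodeKey_of_axWire (f := f) he hat hq
  rw [← h, kind_nodeKey_of_adj he' hl] at this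
  cases this

/-- Results that agree up to renaming come from isomorphic expansions. -/
theorem exists_nodeIso (hF : F.IsLPS) (hF' : F'.IsLPS) (he : F.IsExperiment k e)
    (hat : F.IsAtomic e) (he' : F'.IsExperiment k e')
    (hat' : F'.IsAtomic e') (hinj' : F'.IsInjective e') {t t' : IAtom A ≃. IAtom A}
    (h : EqUnderRen t t' (ind.result e) (ind'.result e')) :
    Nonempty ((ind.forest hF).NodeIso (ind'.forest hF') k 0) := by
  obtain ⟨-, ht', heq⟩ := h
  have hlen : Nat.card F.conclusions = Nat.card F'.conclusions := by
    simpa only [Indexing.result, List.length_map, List.length_ofFn] using congrArg List.length heq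
  let f : IAtom A → IAtom A := fun d => (t d).getD d
  let f' : IAtom A → IAtom A := fun d => (t' d).getD d
  let β : F.conclusions ≃ F'.conclusions := (ind.trans (finCongr hlen)).trans ind'.symm
  have hβ : ∀ c, (ind' (β c) : ℕ) = ind c := fun c =>
    congrArg Fin.val (Equiv.apply_symm_apply ind' (finCongr hlen (ind c)))
  have hpt : ∀ c, (e' (β c)).map f' = (e c).map f := by
    intro c
    have h₁ : (ind c : ℕ) < ((ind.result e).map (ren t)).length := by
      simp only [Indexing.result, List.length_map, List.length_ofFn]
      exact (ind c).2
    have h₂ := List.getElem_of_eq heq h₁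
    simp only [Indexing.result, List.getElem_map, List.getElem_ofFn, Fin.eta,
      Equiv.symm_apply_apply] at h₂
    exact h₂.symm
  let β₀ := ((rootEquiv ind hF k).trans β).trans (rootEquiv ind' hF' k).symm
  obtain ⟨ψ, hψ, hK⟩ := exists_equiv_of_map_children_eq
    (Node.par (S := ind.forest hF) (k := k) (D := 0))
    (Node.par (S := ind'.forest hF') (k := k) (D := 0)) Node.children Node.children
    (fun _ _ => Node.mem_children) (fun _ _ => Node.mem_children)
    (exists_nodeHeight ind hF k) (exists_nodeHeight ind' hF' k) (nodeKey f e) (nodeKey f' e') β₀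
    (fun x => by
      have hx := nodePar_eq_iff.mp x.2
      have hy := nodePar_eq_iff.mp (β₀ x).2
      have hxy : (⟨(β₀ x).1.1.1, hy⟩ : F'.conclusions) = β ⟨x.1.1.1, hx⟩ := rfl
      rw [nodeKey_root he hat hx, nodeKey_root he' hat' hy, hxy, hβ]
      have h₁ : (e' (β₀ x).1.1.1).map f' = (e x.1.1.1).map f := hpt ⟨x.1.1.1, hx⟩
      have h₂ := congrArg Point.kind h₁
      rw [Point.kind_map, Point.kind_map] at h₂
      rw [h₁, h₂])
    (fun x y => map_children_eq he hat he' hat' x y)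
  refine ⟨ψ, hψ, fun x => ?_, fun x => congrArg Prod.snd (hK x), fun x => by simp⟩
  -- A node off the axioms is its own partner, and its image is off the axioms as well because the
  -- keys agree.
  by_cases hx : F.prt x.1.1 = x.1.1
  · have h₁ : x.prt = x := Node.ext' hx rfl
    have h₂ : (ψ x).prt = ψ x := by
      refine Node.ext' ?_ rfl
      change F'.prt (ψ x).1.1 = (ψ x).1.1
      by_contra hc
      obtain ⟨q, hq⟩ := axWire_of_nodeKey_eq he' hat' he (hK x).symm (axWire_prt hc)
      exact hq.ne (hx.symm.trans hq.prt_eq)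
    rw [h₁, h₂]
  · have hq := axWire_prt hx
    have hq₂ : F.AxWire x.prt.1.1 x.1.1 := hq.symm
    obtain ⟨q', hq'⟩ := axWire_of_nodeKey_eq he hat he' (hK x) hq
    obtain ⟨q₂', hq₂'⟩ := axWire_of_nodeKey_eq he hat he' (hK x.prt) hq₂
    obtain ⟨g, hg, -, hgx⟩ := nodeLabel_of_axWire he hat hq
    obtain ⟨g₂, -, hg₂, hgx₂⟩ := nodeLabel_of_axWire he hat hq₂
    obtain ⟨g', hg', -, hgy⟩ := nodeLabel_of_axWire he' hat' hq'
    obtain ⟨g₂', hg₂', -, hgy₂⟩ := nodeLabel_of_axWire he' hat' hq₂'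
    obtain rfl : g₂ = g :=
      (Prod.mk.inj (Point.atom_injective (hg₂.symm.trans hg))).1
    have e₁ : (nodeLabel e' (ψ x)).map f' = (nodeLabel e x).map f := congrArg Prod.fst (hK x)
    have e₂ : (nodeLabel e' (ψ x.prt)).map f' = (nodeLabel e x.prt).map f :=
      congrArg Prod.fst (hK x.prt)
    rw [hgx, hgy] at e₁
    rw [hgx₂, hgy₂] at e₂
    -- `x` and its partner carry the same indexed atom, so the images carry atoms identified by
    -- `t'`. Both lie in the domain of `t'`, hence are equal; injectivity of `e'` then puts the
    -- images on one axiom, with equal indices, and injectivity of `ψ` keeps them distinct.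
    have e₃ : f' (g₂', code (ψ x.prt).1.2) = f' (g', code (ψ x).1.2) :=
      (Point.atom_injective e₂).trans (Point.atom_injective e₁).symm
    have d₁ := renDom_nodeLabel (hF := hF') he' ht' (ψ x)
    have d₂ := renDom_nodeLabel (hF := hF') he' ht' (ψ x.prt)
    rw [hgy] at d₁
    rw [hgy₂] at d₂
    obtain ⟨b₁, hb₁⟩ := Option.isSome_iff_exists.mp (d₁ _ rfl)
    obtain ⟨b₂, hb₂⟩ := Option.isSome_iff_exists.mp (d₂ _ rfl)
    simp only [f', hb₁, hb₂, Option.getD_some] at e₃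
    subst e₃
    obtain ⟨rfl, hcode⟩ := Prod.mk.inj (t'.inj hb₂ hb₁)
    have hcode := code_injective hcode
    rcases hinj'.eq_or_eq hq' hq₂' hg' hg₂' with hc | hc
    · have := ψ.injective (Node.ext' hc hcode : ψ x.prt = ψ x)
      exact absurd (congrArg (fun y => y.1.1) this) hx
    · refine Node.ext' (hc.trans ?_) hcode
      exact hq'.prt_eq.symm

end PPLPS
end PNet

/-! ### The theorem -/

theorem mainTheorem5
    {A : Type*} {C P C' P' : Type*} [Fintype C] [Fintype P] [Fintype C'] [Fintype P']
    (F : PNet.PPLPS C P) (hF : F.IsLPS) (ind : F.Indexing)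
    (F' : PNet.PPLPS C' P') (hF' : F'.IsLPS) (ind' : F'.Indexing)
    (k : ℕ) (hk : F.cosize < k) (hk' : F'.cosize < k)
    (e : P → PNet.IPoint A) (r : List (PNet.IPoint A))
    (he : F.IsExperiment k e) (hr : r = ind.result e)
    (hat : F.IsAtomic e) (hinj : F.IsInjective e)
    (e' : P' → PNet.IPoint A) (r' : List (PNet.IPoint A))
    (he' : F'.IsExperiment k e') (hr' : r' = ind'.result e')
    (hat' : F'.IsAtomic e') (hinj' : F'.IsInjective e')
    (hren : ∃ t t' : PNet.IAtom A ≃. PNet.IAtom A, PNet.EqUnderRen t t' r r') :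
    PNet.PPLPS.ExpIsoAt ind ind' e r e' r' ∧ Nonempty (PNet.PPLPS.IndIso ind ind') := by
  subst hr hr'
  obtain ⟨t, t', h⟩ := hren
  have : NeZero k := ⟨(Nat.zero_le _).trans_lt hk |>.ne'⟩
  obtain ⟨ψ⟩ := PNet.PPLPS.exists_nodeIso hF hF' he hat he' hat' hinj' h
  obtain ⟨φ, h₁, h₂, h₃, h₄⟩ := PNet.BoxForest.exists_equiv_of_nodeIso
    (ind.forest_isBounded hF hk) (ind'.forest_isBounded hF' hk') ψ
  have hφ : PNet.PPLPS.PortEquiv ind ind' φ := ⟨h₁, h₂, fun p => congrArg Prod.fst (h₃ p),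
    fun p => congrArg (fun q => q.2.1) (h₃ p), fun p => congrArg (fun q => q.2.2) (h₃ p), h₄⟩
  exact ⟨hφ.expIsoAt hF.isPLPS hF'.isPLPS he hat hinj he' hat' hinj',
    ⟨hφ.indIso hF.isPLPS hF'.isPLPS⟩⟩
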